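/- A directed strongly regular graph with parameters $(v,k,t,\lambda,\mu)$, written DSRG$(v,k,t,\lambda,\mu)$, is a directed graph $\Gamma=(V,E)$, $E\subseteq V\times V$, without loops on $|V|=v$ vertices such that every vertex has in-degree and out-degree $k$, every vertex $x$ has exactly $t$ out-neighbours that are also in-neighbours of $x$, and for any two distinct vertices $x,y$ the number of directed paths of length two from $x$ to $y$ (that is, of vertices $z$ with $(x,z)\in E$ and $(z,y)\in E$) is $\lambda$ if $(x,y)\in E$ and $\mu$ if $(x,y)\notin E$. An automorphism of $\Gamma$ is a permutation $\sigma$ of $V$ such that, for all $x,y\in V$, $(x,y)\in E$ if and only if $(\sigma(x),\sigma(y))\in E$. **Theorem 4.1.** Let $\rho$ be an automorphism of prime order $p$ of a DSRG$(22,9,6,3,4)$, and let $f_p$ be the number of vertices fixed by $\rho$. Then $p\in\{2,3\}$, and the following holds: 1. if $p=2$, then $f_2\in\{0,6,8,10,12,14,16\}$; 2. if $p=3$, then $f_3=1$. -/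

import Mathlib

/-- `G` is a directed strongly regular graph with parameters `(v, k, t, lam, mu)`: a loopless
directed graph on `v` vertices in which every vertex has out-degree and in-degree `k`, every vertex
has `t` out-neighbours that are also in-neighbours, and for distinct vertices `x`, `y` the number
of directed paths of length two from `x` to `y` is `lam` if there is an edge from `x` to `y`, and
`mu` if there is none. -/
structure Digraph.IsDSRG {V : Type*} [Fintype V] (G : Digraph V) (v k t lam mu : ℕ) : Prop where
  card_eq : Fintype.card V = v
  loopless : ∀ x, ¬ G.Adj x x
  outDegree_eq : ∀ x, {y | G.Adj x y}.ncard = k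
  inDegree_eq : ∀ x, {y | G.Adj y x}.ncard = k
  reciprocal_eq : ∀ x, {y | G.Adj x y ∧ G.Adj y x}.ncard = t
  paths_of_adj : ∀ x y, x ≠ y → G.Adj x y → {z | G.Adj x z ∧ G.Adj z y}.ncard = lam
  paths_of_not_adj : ∀ x y, x ≠ y → ¬ G.Adj x y → {z | G.Adj x z ∧ G.Adj z y}.ncard = mu

/-- The full automorphism group of a directed graph: the permutations `σ` of the vertices such that
there is an edge from `x` to `y` if and only if there is an edge from `σ x` to `σ y`. -/
def Digraph.autGroup {V : Type*} (G : Digraph V) : Subgroup (Equiv.Perm V) where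
  carrier := {σ | ∀ x y, G.Adj x y ↔ G.Adj (σ x) (σ y)}
  one_mem' := fun _ _ => Iff.rfl
  mul_mem' := fun {a b} ha hb x y => (hb x y).trans (ha (b x) (b y))
  inv_mem' := fun {a} ha x y => by
    have h := ha (a⁻¹ x) (a⁻¹ y)
    simpa using h.symm

/-!
Let `A` be the adjacency matrix of the digraph; the parameters say that
`A ^ 2 + A = 2 I + 4 J`, and all row and column sums are `9`. Split `A` along the orbits of the
automorphism of order `p`: into fixed points and `m > 0` orbits of length `p`, where
`f + m p = 22`. The blocks between orbits are circulant, so they are subsets of `ZMod p`, and the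
equation becomes a system of equations between `0`-`1` functions on the fixed points and on
`ZMod p` (`OrbitData`). Everything is deduced from this system.

* A two-step path between fixed points that leaves the set of fixed points comes with `p`
  translates. As there are at most six such paths, for `p ≥ 7` they all stay inside. Then a fixed
  point has at least six, hence all nine, of its out-neighbours among the fixed points, and no path
  leads from it to an orbit. So `f = 0` (`isEmpty_of_seven_le`) and `p = 11`.
  For `p = 5` the numbers of paths inside the set of fixed points contradict the out-degrees, which
  are `4` or `9` (`false_of_five`).
* For `p = 11` there are two orbits, and the blocks satisfy `a ^ 2 + a + b c = 2 + 4 ∑ g` in the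
  group ring of `ZMod 11`, with sets `a`, `b`, `c` of sizes `5`, `4`, `4`. The coefficient at the
  identity, multiplying by a unit of `ZMod 11`, and translating leave few possibilities for `a`.
  They are excluded by evaluating at `4`, an eleventh root of unity modulo
  `1398101 = (4 ^ 11 - 1) / 3` (`CyclicSolution.false`).
* For `p = 2` the out-degrees within the fixed points are odd, which excludes two and four fixed
  points. The equation for the nontrivial character of `ZMod 2` forces three orbits, so
  `f ≤ 16` (`three_le_card_of_two`).
* For `p = 3` the values of a block at a primitive cube root of unity are zero or units of the
  Eisenstein integers. So twice the real part of the product of a block and the opposite block is at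
  most `2`. The terms of this kind off the diagonal add up to at least `4` in each row
  (`crossTerm_cases`, `sum_crossTerm`), so there are at least three orbits and `f ≤ 13`.
  Degrees exclude `f = 4` and `f = 7`.
  For `f = 10` the fixed points form a Petersen graph, in which the orbits cut out equitable
  partitions that do not fit the block sizes (`petersen_of_card_ten`, `card_ne_ten_of_four`).
  For `f = 13` the block sizes are known up to the order of the orbits, the fixed points with
  edges to two orbits form a hexagon, those with edges from two orbits form another one, and these
  hexagons cannot coexist (`r_cases`, `false_of_types`).
-/

/-! ### Splitting the adjacency matrix along orbits -/

/-- The adjacency data of a loopless 9-regular digraph on which a permutation of order `p` acts,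
split along the orbits. `F` is the set of fixed points and `ι` indexes the orbits of length `p`,
each identified with `ZMod p` so that the permutation becomes `s ↦ s + 1`.
`N` is the adjacency matrix on `F`, `W x i` says whether the fixed point `x` has edges to the orbit
`i`, `U i x` whether the orbit `i` has edges to `x`, and `b i j t` whether there are edges from the
point `s` of orbit `i` to the point `s + t` of orbit `j`. All entries are `0` or `1`.
The last four fields express `A ^ 2 + A = 2 I + 4 J` block by block. -/
structure OrbitData (p : ℕ) [NeZero p] (F ι : Type*) [Fintype F] [Fintype ι] [DecidableEq F]
    [DecidableEq ι] where
  N : F → F → ℤ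
  W : F → ι → ℤ
  U : ι → F → ℤ
  b : ι → ι → ZMod p → ℤ
  N_bit : ∀ x y, N x y = 0 ∨ N x y = 1
  W_bit : ∀ x i, W x i = 0 ∨ W x i = 1
  U_bit : ∀ i x, U i x = 0 ∨ U i x = 1
  b_bit : ∀ i j t, b i j t = 0 ∨ b i j t = 1
  N_self : ∀ x, N x x = 0
  b_self : ∀ i, b i i 0 = 0
  out_fixed : ∀ x, ∑ z, N x z + p * ∑ i, W x i = 9
  in_fixed : ∀ x, ∑ z, N z x + p * ∑ i, U i x = 9
  out_orbit : ∀ i, ∑ z, U i z + ∑ j, ∑ s, b i j s = 9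
  in_orbit : ∀ j, ∑ z, W z j + ∑ i, ∑ s, b i j s = 9
  sq_fixed_fixed : ∀ x y, ∑ z, N x z * N z y + p * ∑ i, W x i * U i y + N x y
    = 4 + if x = y then 2 else 0
  sq_fixed_orbit : ∀ x j, ∑ z, N x z * W z j + ∑ i, W x i * ∑ s, b i j s + W x j = 4
  sq_orbit_fixed : ∀ i y, ∑ z, U i z * N z y + ∑ k, (∑ s, b i k s) * U k y + U i y = 4
  sq_orbit_orbit : ∀ i j t, ∑ z, U i z * W z j + ∑ k, ∑ s, b i k s * b k j (t - s) + b i j t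
    = 4 + if i = j ∧ t = 0 then 2 else 0

theorem ncard_setOf_eq_sum {V : Type*} [Fintype V] (P : V → Prop) [DecidablePred P] :
    ({z | P z}.ncard : ℤ) = ∑ z, if P z then (1 : ℤ) else 0 := by
  classical
  rw [Finset.sum_boole, Set.ncard_eq_toFinset_card']
  congr 2
  ext; simp

open Classical in
/-- The adjacency matrix of a digraph, over `ℤ`. -/
noncomputable def Digraph.adjInt {V : Type*} (G : Digraph V) (x y : V) : ℤ :=
  if G.Adj x y then 1 else 0

namespace Digraph.IsDSRG

variable {V : Type*} [Fintype V] {G : Digraph V}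

theorem sum_adjInt_out (hG : G.IsDSRG 22 9 6 3 4) (x : V) : ∑ z, G.adjInt x z = 9 := by
  classical
  have h := ncard_setOf_eq_sum (fun y => G.Adj x y)
  rw [hG.outDegree_eq] at h
  simpa [adjInt] using h.symm

theorem sum_adjInt_in (hG : G.IsDSRG 22 9 6 3 4) (x : V) : ∑ z, G.adjInt z x = 9 := by
  classical
  have h := ncard_setOf_eq_sum (fun y => G.Adj y x)
  rw [hG.inDegree_eq] at h
  simpa [adjInt] using h.symm

/-- The matrix equation `A ^ 2 + A = 2 I + 4 J`, entry by entry. -/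
theorem adjInt_sq [DecidableEq V] (hG : G.IsDSRG 22 9 6 3 4) (x y : V) :
    ∑ z, G.adjInt x z * G.adjInt z y + G.adjInt x y = 4 + if x = y then 2 else 0 := by
  classical
  have h := ncard_setOf_eq_sum (fun z => G.Adj x z ∧ G.Adj z y)
  have h2 : ∑ z, G.adjInt x z * G.adjInt z y
      = ∑ z, if G.Adj x z ∧ G.Adj z y then (1 : ℤ) else 0 := by
    refine Finset.sum_congr rfl fun z _ => ?_
    by_cases h1 : G.Adj x z <;> by_cases h2 : G.Adj z y <;> simp [adjInt, h1, h2]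
  rw [h2, ← h]
  by_cases hxy : x = y
  · subst hxy
    rw [hG.reciprocal_eq]
    simp [adjInt, hG.loopless]
  · by_cases ha : G.Adj x y
    · rw [hG.paths_of_adj x y hxy ha]; simp [adjInt, ha, hxy]
    · rw [hG.paths_of_not_adj x y hxy ha]; simp [adjInt, ha, hxy]

end Digraph.IsDSRG

section Orbits

variable {V : Type*} {p : ℕ} [Fact p.Prime] (ρ : Equiv.Perm V)

theorem pow_val_add (hρ : orderOf ρ = p) (s t : ZMod p) :
    ρ ^ (s + t).val = ρ ^ s.val * ρ ^ t.val := by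
  have h := pow_mod_orderOf ρ (s.val + t.val)
  rw [hρ] at h
  rw [ZMod.val_add, ← pow_add, h]

theorem pow_val_intCast (hρ : orderOf ρ = p) (i : ℤ) : ρ ^ ((i : ZMod p)).val = ρ ^ i := by
  rw [← zpow_natCast, ← zpow_mod_orderOf ρ i, hρ, ZMod.val_intCast]

theorem pow_val_ne_self (hρ : orderOf ρ = p) {x : V} (hx : ρ x ≠ x) {s : ZMod p} (hs : s ≠ 0) :
    (ρ ^ s.val) x ≠ x := by
  intro h
  apply hx
  have hco : Nat.Coprime s.val p := by
    rw [Nat.coprime_comm, Nat.Prime.coprime_iff_not_dvd Fact.out]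
    intro hd
    have := Nat.le_of_dvd (Nat.pos_of_ne_zero (by simpa using hs)) hd
    exact absurd (ZMod.val_lt s) (by omega)
  have h1 : Function.IsPeriodicPt ρ s.val x := by
    rw [Function.IsPeriodicPt, Function.IsFixedPt, ← Equiv.Perm.coe_pow]; exact h
  have h2 : Function.IsPeriodicPt ρ p x := by
    rw [Function.IsPeriodicPt, Function.IsFixedPt, ← Equiv.Perm.coe_pow, ← hρ, pow_orderOf_eq_one]
    rfl
  have h3 := h1.gcd h2
  rw [hco.gcd_eq_one] at h3
  simpa [Function.IsPeriodicPt, Function.IsFixedPt] using h3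

/-- The moved points of `ρ` up to lying on the same cycle. -/
def movedSetoid : Setoid {x : V // ρ x ≠ x} := (Equiv.Perm.SameCycle.setoid ρ).comap Subtype.val

/-- Coordinates on `V` for a permutation of order `p`: a fixed point, or an orbit of length `p`
together with the power of `ρ` that leads to the point from a chosen representative. -/
theorem exists_orbit_equiv [Fintype V] (hρ : orderOf ρ = p) :
    ∃ (f m : ℕ) (e : Fin f ⊕ (Fin m × ZMod p) ≃ V), (∀ x, ρ (e (.inl x)) = e (.inl x)) ∧
      (∀ i s, ρ (e (.inr (i, s))) = e (.inr (i, s + 1))) ∧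
      f = (Function.fixedPoints ρ).ncard ∧ 0 < m ∧ f + m * p = Fintype.card V := by
  classical
  have hp : p.Prime := Fact.out
  let := movedSetoid ρ
  let g : {x : V // ρ x = x} ⊕ (Quotient (movedSetoid ρ) × ZMod p) → V :=
    Sum.elim (fun x => x.1) (fun q => (ρ ^ q.2.val) q.1.out.1)
  have hmoved : ∀ (q : Quotient (movedSetoid ρ)) (s : ZMod p),
      ρ ((ρ ^ s.val) q.out.1) ≠ (ρ ^ s.val) q.out.1 := by
    intro q s h
    apply q.out.2
    rw [← Equiv.Perm.mul_apply, ← pow_succ', pow_succ, Equiv.Perm.mul_apply] at h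
    exact (ρ ^ s.val).injective h
  have hinj : Function.Injective g := by
    rintro (x | ⟨q, s⟩) (y | ⟨r, t⟩) h
    · simp only [g, Sum.elim_inl] at h
      rw [Subtype.ext h]
    · simp only [g, Sum.elim_inl, Sum.elim_inr] at h
      exact absurd (h ▸ x.2) (hmoved r t)
    · simp only [g, Sum.elim_inl, Sum.elim_inr] at h
      exact absurd (h ▸ y.2) (hmoved q s)
    · simp only [g, Sum.elim_inr] at h
      have hqr : q = r := by
        rw [← q.out_eq, ← r.out_eq]
        apply Quotient.sound
        change Equiv.Perm.SameCycle ρ _ _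
        refine ⟨((s.val : ℤ) - t.val), ?_⟩
        have h' := congrArg (ρ ^ (-(t.val : ℤ))) h
        rw [← zpow_natCast, ← zpow_natCast, ← Equiv.Perm.mul_apply, ← Equiv.Perm.mul_apply,
          ← zpow_add, ← zpow_add, neg_add_cancel, zpow_zero, neg_add_eq_sub] at h'
        exact h'
      subst hqr
      by_contra hne
      have hst : s - t ≠ 0 := by
        intro h0; apply hne; rw [sub_eq_zero.mp h0]
      apply pow_val_ne_self ρ hρ q.out.2 hst
      have : s = t + (s - t) := by ring
      rw [this, pow_val_add ρ hρ, Equiv.Perm.mul_apply] at h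
      exact (ρ ^ t.val).injective h
  have hsurj : Function.Surjective g := by
    intro y
    by_cases hy : ρ y = y
    · exact ⟨.inl ⟨y, hy⟩, rfl⟩
    · have := Quotient.mk_out (s := movedSetoid ρ) ⟨y, hy⟩
      obtain ⟨i, hi⟩ : Equiv.Perm.SameCycle ρ _ _ := this
      refine ⟨.inr (Quotient.mk _ ⟨y, hy⟩, (i : ZMod p)), ?_⟩
      simp only [g, Sum.elim_inr]
      rw [pow_val_intCast ρ hρ, hi]
  let e₀ := Equiv.ofBijective g ⟨hinj, hsurj⟩
  have : Finite (Quotient (movedSetoid ρ)) := inferInstance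
  let : Fintype (Quotient (movedSetoid ρ)) := Fintype.ofFinite _
  let e₁ := Fintype.equivFin {x : V // ρ x = x}
  let e₂ := Fintype.equivFin (Quotient (movedSetoid ρ))
  refine ⟨_, _, (Equiv.sumCongr e₁.symm (Equiv.prodCongr e₂.symm (Equiv.refl _))).trans e₀,
    ?_, ?_, ?_, ?_, ?_⟩
  · intro x
    exact (e₁.symm x).2
  · intro i s
    change ρ ((ρ ^ s.val) (e₂.symm i).out.1) = (ρ ^ (s + 1).val) (e₂.symm i).out.1
    rw [add_comm, pow_val_add ρ hρ, Equiv.Perm.mul_apply, ZMod.val_one, pow_one]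
  · rw [← Nat.card_coe_set_eq, ← Nat.card_eq_fintype_card]
    rfl
  · rw [Fintype.card_pos_iff]
    by_contra hne
    have h1 : ρ = 1 := by
      ext x
      by_contra hx
      exact hne ⟨Quotient.mk _ ⟨x, hx⟩⟩
    rw [h1, orderOf_one] at hρ
    exact hp.one_lt.ne hρ
  · rw [← Fintype.card_congr e₀]
    simp [ZMod.card]

end Orbits

/-- The edges of the digraph, in coordinates adapted to an automorphism of prime order. -/
theorem OrbitData.exists_of_isDSRG {V : Type*} [Fintype V] {G : Digraph V}
    (hG : G.IsDSRG 22 9 6 3 4) {ρ : Equiv.Perm V} (hρ : ρ ∈ G.autGroup) {p : ℕ} [Fact p.Prime]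
    (hord : orderOf ρ = p) :
    ∃ f m : ℕ, f = (Function.fixedPoints ρ).ncard ∧ 0 < m ∧ f + m * p = 22 ∧
      Nonempty (OrbitData p (Fin f) (Fin m)) := by
  classical
  obtain ⟨f, m, e, he1, he2, hf, hm, hcard⟩ := exists_orbit_equiv ρ hord
  refine ⟨f, m, hf, hm, hG.card_eq ▸ hcard, ?_⟩
  have hinv1 : ∀ x y, G.adjInt (ρ x) (ρ y) = G.adjInt x y := by
    intro x y
    simp only [Digraph.adjInt, ← hρ x y]
  have hinv : ∀ (k : ℕ) x y, G.adjInt ((ρ ^ k) x) ((ρ ^ k) y) = G.adjInt x y := by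
    intro k
    induction k with
    | zero => simp
    | succ k ih =>
      intro x y
      rw [pow_succ', Equiv.Perm.mul_apply, Equiv.Perm.mul_apply, hinv1, ih]
  have hk1 : ∀ (k : ℕ) x, (ρ ^ k) (e (.inl x)) = e (.inl x) := by
    intro k
    induction k with
    | zero => simp
    | succ k ih => intro x; rw [pow_succ, Equiv.Perm.mul_apply, he1, ih]
  have hk2 : ∀ (k : ℕ) i s, (ρ ^ k) (e (.inr (i, s))) = e (.inr (i, s + k)) := by
    intro k
    induction k with
    | zero => simp
    | succ k ih =>
      intro i s
      rw [pow_succ, Equiv.Perm.mul_apply, he2, ih]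
      congr 3; push_cast; ring
  have hW : ∀ x i s, G.adjInt (e (.inl x)) (e (.inr (i, s)))
      = G.adjInt (e (.inl x)) (e (.inr (i, 0))) := by
    intro x i s
    rw [← hinv s.val _ (e (.inr (i, 0))), hk1, hk2]; simp
  have hU : ∀ x i s, G.adjInt (e (.inr (i, s))) (e (.inl x))
      = G.adjInt (e (.inr (i, 0))) (e (.inl x)) := by
    intro x i s
    rw [← hinv s.val (e (.inr (i, 0))), hk1, hk2]; simp
  have hb : ∀ i j s t, G.adjInt (e (.inr (i, s))) (e (.inr (j, t)))
      = G.adjInt (e (.inr (i, 0))) (e (.inr (j, t - s))) := by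
    intro i j s t
    rw [← hinv s.val (e (.inr (i, 0))), hk2, hk2]; simp
  have hbit : ∀ x y, G.adjInt x y = 0 ∨ G.adjInt x y = 1 := by
    intro x y
    unfold Digraph.adjInt
    split_ifs <;> simp
  have hself : ∀ x, G.adjInt x x = 0 := fun x => by simp [Digraph.adjInt, hG.loopless]
  have hsum : ∀ h : V → ℤ, ∑ z, h z
      = ∑ z, h (e (.inl z)) + ∑ i, ∑ s, h (e (.inr (i, s))) := by
    intro h
    rw [← e.sum_comp, Fintype.sum_sum_type, Fintype.sum_prod_type]
  refine ⟨{ N := fun x y => G.adjInt (e (.inl x)) (e (.inl y))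
            W := fun x i => G.adjInt (e (.inl x)) (e (.inr (i, 0)))
            U := fun i x => G.adjInt (e (.inr (i, 0))) (e (.inl x))
            b := fun i j t => G.adjInt (e (.inr (i, 0))) (e (.inr (j, t)))
            N_bit := fun _ _ => hbit _ _
            W_bit := fun _ _ => hbit _ _
            U_bit := fun _ _ => hbit _ _
            b_bit := fun _ _ _ => hbit _ _
            N_self := fun _ => hself _
            b_self := fun _ => hself _
            out_fixed := ?_
            in_fixed := ?_
            out_orbit := ?_
            in_orbit := ?_
            sq_fixed_fixed := ?_
            sq_fixed_orbit := ?_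
            sq_orbit_fixed := ?_
            sq_orbit_orbit := ?_ }⟩
  · intro x
    have h := hG.sum_adjInt_out (e (.inl x))
    rw [hsum] at h
    simp only [hW x, Finset.sum_const, Finset.card_univ, ZMod.card, nsmul_eq_mul] at h
    rw [Finset.mul_sum]; exact h
  · intro x
    have h := hG.sum_adjInt_in (e (.inl x))
    rw [hsum] at h
    simp only [hU x, Finset.sum_const, Finset.card_univ, ZMod.card, nsmul_eq_mul] at h
    rw [Finset.mul_sum]; exact h
  · intro i
    have h := hG.sum_adjInt_out (e (.inr (i, 0)))
    rw [hsum] at h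
    exact h
  · intro j
    have h := hG.sum_adjInt_in (e (.inr (j, 0)))
    rw [hsum] at h
    rw [← h]
    congr 1
    refine Finset.sum_congr rfl fun i _ => ?_
    rw [← Equiv.sum_comp (Equiv.neg (ZMod p))]
    refine Finset.sum_congr rfl fun s _ => ?_
    rw [hb i j s 0, zero_sub]; rfl
  · intro x y
    have h := hG.adjInt_sq (e (.inl x)) (e (.inl y))
    rw [hsum] at h
    simp only [hW x, hU y, Finset.sum_const, Finset.card_univ, ZMod.card, nsmul_eq_mul] at h
    rw [Finset.mul_sum, h]
    simp
  · intro x j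
    have h := hG.adjInt_sq (e (.inl x)) (e (.inr (j, 0)))
    rw [hsum] at h
    simp only [hW x] at h
    rw [if_neg (by simp), add_zero] at h
    rw [← h]
    congr 2
    refine Finset.sum_congr rfl fun i _ => ?_
    rw [Finset.mul_sum, ← Equiv.sum_comp (Equiv.neg (ZMod p))]
    refine Finset.sum_congr rfl fun s _ => ?_
    rw [hb i j s 0, zero_sub]; rfl
  · intro i y
    have h := hG.adjInt_sq (e (.inr (i, 0))) (e (.inl y))
    rw [hsum] at h
    simp only [hU y] at h
    rw [if_neg (by simp), add_zero] at h
    rw [← h]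
    congr 2
    refine Finset.sum_congr rfl fun k _ => ?_
    rw [Finset.sum_mul]
  · intro i j t
    have h := hG.adjInt_sq (e (.inr (i, 0))) (e (.inr (j, t)))
    rw [hsum] at h
    simp only [hW _ j t] at h
    have h2 : (e (.inr (i, 0)) = e (.inr (j, t))) ↔ (i = j ∧ t = 0) := by
      simp [eq_comm]
    simp only [h2] at h
    rw [← h]
    congr 2
    refine Finset.sum_congr rfl fun k _ => Finset.sum_congr rfl fun s _ => ?_
    rw [hb k j s t]

/-! ### Fixed points and paths between them -/

namespace OrbitData

variable {p : ℕ} [NeZero p] {F ι : Type*} [Fintype F] [Fintype ι] [DecidableEq F] [DecidableEq ι]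

section Basic

variable (D : OrbitData p F ι)

/-- The number of edges from a point of the orbit `i` to the orbit `j`. -/
def r (i j : ι) : ℤ := ∑ s, D.b i j s

/-- The orbit data of the digraph with all edges reversed. -/
def rev : OrbitData p F ι where
  N x y := D.N y x
  W x i := D.U i x
  U i x := D.W x i
  b i j t := D.b j i (-t)
  N_bit x y := D.N_bit y x
  W_bit x i := D.U_bit i x
  U_bit i x := D.W_bit x i
  b_bit i j t := D.b_bit j i (-t)
  N_self := D.N_self
  b_self i := by simpa using D.b_self i
  out_fixed := D.in_fixed
  in_fixed := D.out_fixed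
  out_orbit i := by
    rw [← D.in_orbit i]
    congr 1
    exact Finset.sum_congr rfl fun j _ => Equiv.sum_comp (Equiv.neg (ZMod p)) (D.b j i)
  in_orbit i := by
    rw [← D.out_orbit i]
    congr 1
    exact Finset.sum_congr rfl fun j _ => Equiv.sum_comp (Equiv.neg (ZMod p)) (D.b i j)
  sq_fixed_fixed x y := by
    have h := D.sq_fixed_fixed y x
    simp only [mul_comm (D.N y _), mul_comm (D.W y _), eq_comm (a := y)] at h
    exact h
  sq_fixed_orbit x j := by
    rw [← D.sq_orbit_fixed j x]
    congr 2
    · exact Finset.sum_congr rfl fun z _ => mul_comm _ _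
    · refine Finset.sum_congr rfl fun i _ => ?_
      rw [mul_comm]
      congr 1
      exact Equiv.sum_comp (Equiv.neg (ZMod p)) (D.b j i)
  sq_orbit_fixed i y := by
    rw [← D.sq_fixed_orbit y i]
    congr 2
    · exact Finset.sum_congr rfl fun z _ => mul_comm _ _
    · refine Finset.sum_congr rfl fun j _ => ?_
      rw [mul_comm]
      congr 1
      exact Equiv.sum_comp (Equiv.neg (ZMod p)) (D.b j i)
  sq_orbit_orbit i j t := by
    have h := D.sq_orbit_orbit j i (-t)
    have h2 : (j = i ∧ -t = 0) ↔ (i = j ∧ t = 0) := by rw [neg_eq_zero, eq_comm]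
    simp only [h2] at h
    rw [← h]
    congr 2
    · exact Finset.sum_congr rfl fun z _ => mul_comm _ _
    · refine Finset.sum_congr rfl fun k _ => ?_
      rw [← Equiv.sum_comp (Equiv.addRight t)]
      refine Finset.sum_congr rfl fun s _ => ?_
      rw [mul_comm]
      simp only [Equiv.coe_addRight]
      congr 2 <;> ring

/-- The same orbit data with the orbits indexed differently. -/
def reindex {κ : Type*} [Fintype κ] [DecidableEq κ] (σ : κ ≃ ι) : OrbitData p F κ where
  N := D.N
  W x i := D.W x (σ i)
  U i x := D.U (σ i) x
  b i j t := D.b (σ i) (σ j) t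
  N_bit := D.N_bit
  W_bit _ _ := D.W_bit _ _
  U_bit _ _ := D.U_bit _ _
  b_bit _ _ _ := D.b_bit _ _ _
  N_self := D.N_self
  b_self _ := D.b_self _
  out_fixed x := by rw [σ.sum_comp (fun i => D.W x i)]; exact D.out_fixed x
  in_fixed x := by rw [σ.sum_comp (fun i => D.U i x)]; exact D.in_fixed x
  out_orbit i := by rw [σ.sum_comp (fun j => ∑ s, D.b (σ i) j s)]; exact D.out_orbit _
  in_orbit j := by rw [σ.sum_comp (fun i => ∑ s, D.b i (σ j) s)]; exact D.in_orbit _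
  sq_fixed_fixed x y := by
    rw [σ.sum_comp (fun i => D.W x i * D.U i y)]; exact D.sq_fixed_fixed x y
  sq_fixed_orbit x j := by
    rw [σ.sum_comp (fun i => D.W x i * ∑ s, D.b i (σ j) s)]; exact D.sq_fixed_orbit x _
  sq_orbit_fixed i y := by
    rw [σ.sum_comp (fun k => (∑ s, D.b (σ i) k s) * D.U k y)]; exact D.sq_orbit_fixed _ y
  sq_orbit_orbit i j t := by
    rw [σ.sum_comp (fun k => ∑ s, D.b (σ i) k s * D.b k (σ j) (t - s)),
      D.sq_orbit_orbit (σ i) (σ j) t]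
    simp

theorem r_rev (i j : ι) : D.rev.r i j = D.r j i :=
  Equiv.sum_comp (Equiv.neg (ZMod p)) (D.b j i)

theorem N_nonneg (x y : F) : 0 ≤ D.N x y := by rcases D.N_bit x y with h | h <;> omega
theorem N_le_one (x y : F) : D.N x y ≤ 1 := by rcases D.N_bit x y with h | h <;> omega
theorem W_nonneg (x : F) (i : ι) : 0 ≤ D.W x i := by rcases D.W_bit x i with h | h <;> omega
theorem W_le_one (x : F) (i : ι) : D.W x i ≤ 1 := by rcases D.W_bit x i with h | h <;> omega
theorem U_nonneg (i : ι) (x : F) : 0 ≤ D.U i x := by rcases D.U_bit i x with h | h <;> omega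
theorem U_le_one (i : ι) (x : F) : D.U i x ≤ 1 := by rcases D.U_bit i x with h | h <;> omega
theorem b_nonneg (i j : ι) (t : ZMod p) : 0 ≤ D.b i j t := by
  rcases D.b_bit i j t with h | h <;> omega
theorem b_le_one (i j : ι) (t : ZMod p) : D.b i j t ≤ 1 := by
  rcases D.b_bit i j t with h | h <;> omega

theorem r_nonneg (i j : ι) : 0 ≤ D.r i j := Finset.sum_nonneg fun _ _ => D.b_nonneg _ _ _

theorem r_le (i j : ι) : D.r i j ≤ p := by
  calc D.r i j ≤ ∑ _s : ZMod p, (1 : ℤ) := Finset.sum_le_sum fun _ _ => D.b_le_one _ _ _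
    _ = p := by simp [ZMod.card]

/-- The number of two-step paths between fixed points that pass through fixed points only. -/
def pathsN (x y : F) : ℤ := ∑ z, D.N x z * D.N z y

/-- The number of orbits of length `p` through which two-step paths run from the fixed point `x`
to the fixed point `y`. -/
def K (x y : F) : ℤ := ∑ i, D.W x i * D.U i y

/-- The out-degree within the fixed points. -/
def dout (x : F) : ℤ := ∑ z, D.N x z

theorem K_nonneg (x y : F) : 0 ≤ D.K x y :=
  Finset.sum_nonneg fun _ _ => mul_nonneg (D.W_nonneg _ _) (D.U_nonneg _ _)

theorem pathsN_nonneg (x y : F) : 0 ≤ D.pathsN x y :=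
  Finset.sum_nonneg fun _ _ => mul_nonneg (D.N_nonneg _ _) (D.N_nonneg _ _)

theorem pathsN_le_dout (x y : F) : D.pathsN x y ≤ D.dout x :=
  Finset.sum_le_sum fun _ _ => mul_le_of_le_one_right (D.N_nonneg _ _) (D.N_le_one _ _)

/-- A path from `x` to an out-neighbour `y` does not pass through `y`. -/
theorem pathsN_add_N_le_dout (x y : F) : D.pathsN x y + D.N x y ≤ D.dout x := by
  have h1 : D.N x y = ∑ z, if z = y then D.N x y else 0 := by simp
  rw [h1, pathsN, ← Finset.sum_add_distrib]
  refine Finset.sum_le_sum fun z _ => ?_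
  by_cases hz : z = y
  · subst hz; simp [D.N_self]
  · simp only [hz, if_false, add_zero]
    exact mul_le_of_le_one_right (D.N_nonneg _ _) (D.N_le_one _ _)

theorem pathsN_of_ne {x y : F} (h : x ≠ y) : D.pathsN x y + p * D.K x y + D.N x y = 4 := by
  have := D.sq_fixed_fixed x y
  rwa [if_neg h, add_zero] at this

theorem pathsN_self (x : F) : D.pathsN x x + p * D.K x x = 6 := by
  have := D.sq_fixed_fixed x x
  rwa [if_pos rfl, D.N_self, add_zero] at this

theorem dout_eq (x : F) : D.dout x + p * ∑ i, D.W x i = 9 := D.out_fixed x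

theorem dout_nonneg (x : F) : 0 ≤ D.dout x := Finset.sum_nonneg fun _ _ => D.N_nonneg _ _

theorem sum_W_nonneg (x : F) : 0 ≤ ∑ i, D.W x i := Finset.sum_nonneg fun _ _ => D.W_nonneg _ _

theorem dout_add_one_le (x : F) : D.dout x + 1 ≤ Fintype.card F := by
  have h1 : (1 : ℤ) = ∑ z, if z = x then 1 else 0 := by simp
  have h2 : (Fintype.card F : ℤ) = ∑ _z : F, 1 := by simp
  rw [h1, h2, dout, ← Finset.sum_add_distrib]
  refine Finset.sum_le_sum fun z _ => ?_
  by_cases hz : z = x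
  · subst hz; simp [D.N_self]
  · simpa [hz] using D.N_le_one x z

/-- If a fixed point is joined to all others, then each of them is an out-neighbour. -/
theorem N_eq_one_of_dout {x z : F} (hd : D.dout x + 1 = Fintype.card F) (hz : z ≠ x) :
    D.N x z = 1 := by
  by_contra h0
  have h0 : D.N x z = 0 := by have := D.N_bit x z; omega
  have : D.dout x + 2 ≤ Fintype.card F := by
    have e1 : (1 : ℤ) = ∑ y, if y = x then 1 else 0 := by simp
    have e2 : (1 : ℤ) = ∑ y, if y = z then 1 else 0 := by simp
    have e3 : (Fintype.card F : ℤ) = ∑ _z : F, 1 := by simp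
    rw [show (2 : ℤ) = 1 + 1 by rfl]
    nth_rewrite 1 [e1]
    rw [e2, e3, dout, ← Finset.sum_add_distrib, ← Finset.sum_add_distrib]
    refine Finset.sum_le_sum fun y _ => ?_
    by_cases hy : y = x
    · subst hy; simp [D.N_self, hz.symm]
    · by_cases hy' : y = z
      · subst hy'; simp [hy, h0]
      · simpa [hy, hy'] using D.N_le_one x y
  omega

theorem sum_pathsN (x : F) : ∑ y, D.pathsN x y = ∑ z, D.N x z * D.dout z := by
  simp only [pathsN, dout, Finset.mul_sum]
  exact Finset.sum_comm

/-- If no fixed point has edges to a moved point there are no paths from a fixed point to a moved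
one. -/
theorem not_forall_sum_W_eq_zero [Nonempty F] [Nonempty ι] : ¬ ∀ x, ∑ i, D.W x i = 0 := by
  intro h
  have h0 : ∀ x i, D.W x i = 0 := fun x i =>
    (Finset.sum_eq_zero_iff_of_nonneg fun _ _ => D.W_nonneg _ _).mp (h x) i (Finset.mem_univ _)
  have := D.sq_fixed_orbit (Classical.arbitrary F) (Classical.arbitrary ι)
  simp [h0] at this

/-- For `p ≥ 7` all paths between fixed points stay within the fixed points, so that each fixed
point has at least six, hence all nine, of its out-neighbours among them. -/
theorem isEmpty_of_seven_le (D : OrbitData p F ι) [Nonempty ι] (hp : 7 ≤ p) : IsEmpty F := by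
  by_contra hF
  rw [not_isEmpty_iff] at hF
  have hp' : (7 : ℤ) ≤ p := by exact_mod_cast hp
  apply D.not_forall_sum_W_eq_zero
  intro x
  have h1 := D.pathsN_self x
  have h2 := D.pathsN_le_dout x x
  have h3 := D.dout_eq x
  have h4 := D.sum_W_nonneg x
  have h5 := D.K_nonneg x x
  have h6 := D.pathsN_nonneg x x
  have hK : D.K x x = 0 := by nlinarith
  rw [hK] at h1
  nlinarith

end Basic

/-- A fixed point `x` with edges to the orbits has out-degree four within the fixed points, since
nine is the only other possible value. The two-step paths from `x` to other fixed points run within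
the fixed points, and there are too many of them for these degrees. -/
theorem false_of_five [Nonempty ι] (D : OrbitData 5 F ι)
    (hc : Fintype.card F + 5 * Fintype.card ι = 22) : False := by
  have hne : Nonempty F := by
    rw [← Fintype.card_pos_iff]; omega
  have hι : 0 < Fintype.card ι := Fintype.card_pos
  have hnot := D.not_forall_sum_W_eq_zero
  push Not at hnot
  obtain ⟨x, hx⟩ := hnot
  have hW := D.sum_W_nonneg x
  have h3 := D.dout_eq x
  have h4 := D.dout_add_one_le x
  have h4n := D.dout_nonneg x
  push_cast at h3
  have hd : D.dout x = 4 := by omega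
  -- at most four two-step paths lead to a second fixed point, so none of them meets an orbit
  have hK : ∀ y, y ≠ x → D.pathsN x y = 4 - D.N x y := by
    intro y hy
    have h1 := D.pathsN_of_ne hy.symm
    have h2 := D.K_nonneg x y
    have h5 := D.pathsN_nonneg x y
    have h6 := D.N_nonneg x y
    push_cast at h1
    omega
  have hself := D.pathsN_self x
  have hself' := D.pathsN_nonneg x x
  push_cast at hself
  have hsum : ∑ y, D.pathsN x y = D.pathsN x x + 4 * (Fintype.card F - 1) - 4 := by
    have h1 : ∀ y, D.pathsN x y = (4 - D.N x y) + if y = x then D.pathsN x x - 4 else 0 := by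
      intro y
      by_cases hy : y = x
      · subst hy; simp [D.N_self]
      · simp [hy, hK y hy]
    have h2 : ∑ y, D.N x y = 4 := hd
    rw [Finset.sum_congr rfl fun y _ => h1 y, Finset.sum_add_distrib, Finset.sum_sub_distrib, h2]
    simp
    ring
  rw [D.sum_pathsN] at hsum
  have hle : ∑ z, D.N x z * D.dout z ≤ 4 * 9 := by
    rw [← hd, dout, Finset.sum_mul]
    refine Finset.sum_le_sum fun z _ => mul_le_mul_of_nonneg_left ?_ (D.N_nonneg _ _)
    have := D.dout_eq z
    have := D.sum_W_nonneg z
    push_cast at *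
    omega
  -- with at most seven fixed points, the out-degree nine is impossible as well
  have hcase : Fintype.card F = 7 := by omega
  have hle' : ∑ z, D.N x z * D.dout z ≤ 4 * 4 := by
    rw [← hd]
    nth_rewrite 2 [dout]
    rw [mul_comm, Finset.sum_mul]
    refine Finset.sum_le_sum fun z _ => mul_le_mul_of_nonneg_left ?_ (D.N_nonneg _ _)
    have := D.dout_eq z
    have := D.sum_W_nonneg z
    have := D.dout_add_one_le z
    push_cast at *
    omega
  omega

/-! ### Involutions -/

section Involution

theorem dout_odd (D : OrbitData 2 F ι) (x : F) : D.dout x % 2 = 1 := by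
  have := D.dout_eq x
  push_cast at this
  omega

/-- Let `B i k = b i k 0 - b i k 1`, which is `0` or `±1`. On functions that change sign under the
involution `A` acts as `B` and `J` vanishes, so `∑ k, B i k * B k i = 2 - B i i`. As `B i i` is `0`
or `-1`, the products with `k ≠ i` add up to two, and each of them is at most one. -/
theorem three_le_card_of_two (D : OrbitData 2 F ι) (i : ι) : 3 ≤ Fintype.card ι := by
  have h0 := D.sq_orbit_orbit i i 0
  have h1 := D.sq_orbit_orbit i i 1
  have h10 : (1 : ZMod 2) ≠ 0 := by decide
  rw [if_pos ⟨rfl, rfl⟩] at h0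
  rw [if_neg (fun h => h10 h.2)] at h1
  have hu : ∀ f : ZMod 2 → ℤ, ∑ s, f s = f 0 + f 1 := fun f => Fin.sum_univ_two f
  have hdiff : ∑ k, ((D.b i k 0 - D.b i k 1) * (D.b k i 0 - D.b k i 1)) = 2 + D.b i i 1 := by
    have e : ∀ k, (D.b i k 0 - D.b i k 1) * (D.b k i 0 - D.b k i 1)
        = ∑ s, D.b i k s * D.b k i (0 - s) - ∑ s, D.b i k s * D.b k i (1 - s) := by
      intro k
      rw [hu, hu]
      have e1 : (0 : ZMod 2) - 1 = 1 := by decide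
      rw [e1, sub_zero, sub_zero, sub_self]
      ring
    rw [Finset.sum_congr rfl fun k _ => e k, Finset.sum_sub_distrib]
    have := D.b_self i
    linarith
  have hsplit := Finset.add_sum_erase Finset.univ
    (fun k => (D.b i k 0 - D.b i k 1) * (D.b k i 0 - D.b k i 1)) (Finset.mem_univ i)
  have hle : ∑ k ∈ Finset.univ.erase i, ((D.b i k 0 - D.b i k 1) * (D.b k i 0 - D.b k i 1))
      ≤ ∑ k ∈ Finset.univ.erase i, (1 : ℤ) := by
    refine Finset.sum_le_sum fun k _ => ?_
    rcases D.b_bit i k 0 with h | h <;> rcases D.b_bit i k 1 with h' | h' <;>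
    rcases D.b_bit k i 0 with h'' | h'' <;> rcases D.b_bit k i 1 with h''' | h''' <;>
    simp [h, h', h'', h''']
  rw [hdiff, D.b_self] at hsplit
  simp only [Finset.sum_const, Finset.card_erase_of_mem (Finset.mem_univ i), Finset.card_univ,
    nsmul_eq_mul, mul_one] at hle
  have hc : 0 < Fintype.card ι := Fintype.card_pos_iff.mpr ⟨i⟩
  rw [Nat.cast_sub hc] at hle
  rcases D.b_bit i i 1 with h | h <;> rw [h] at hsplit <;> push_cast at hle <;> omega

/-- The out-degree within two fixed points is at most one, hence equal to one by parity. Then the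
two-step paths from one to the other, which come in pairs, would number `4 - 1`. -/
theorem card_ne_two_of_two (D : OrbitData 2 F ι) : Fintype.card F ≠ 2 := by
  intro hc
  have e := Fintype.equivFinOfCardEq hc
  have hne : e.symm 0 ≠ e.symm 1 := by simp
  have hsum : ∀ g : F → ℤ, ∑ z, g z = g (e.symm 0) + g (e.symm 1) := fun g => by
    rw [← e.symm.sum_comp, Fin.sum_univ_two]
  have h := D.pathsN_of_ne hne
  have h1 := D.dout_odd (e.symm 0)
  rw [pathsN, hsum, D.N_self, D.N_self] at h
  rw [dout, hsum, D.N_self] at h1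
  have := D.N_bit (e.symm 0) (e.symm 1)
  push_cast at h
  omega

/-- On four fixed points all degrees within the fixed points are odd and all numbers of reciprocal
edges are even. So all these degrees are one, and the fixed points form a directed cycle. -/
theorem card_ne_four_of_two (D : OrbitData 2 F ι) : Fintype.card F ≠ 4 := by
  intro hc
  have hout : ∀ x, D.dout x = 1 := by
    intro x
    have h1 := D.dout_odd x
    have h2 := D.rev.dout_odd x
    have h3 := D.dout_add_one_le x
    have h4 := D.rev.dout_add_one_le x
    have h5 := D.dout_nonneg x
    have h6 := D.pathsN_self x
    by_contra hne
    have hd : D.dout x = 3 := by omega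
    -- all other vertices are out-neighbours of `x`, so its in-neighbours are reciprocal
    have hall : ∀ z, z ≠ x → D.N x z = 1 := fun z hz => D.N_eq_one_of_dout (by omega) hz
    have hrec : D.pathsN x x = D.rev.dout x := by
      refine Finset.sum_congr rfl fun z _ => ?_
      by_cases hz : z = x
      · subst hz; simp [rev, D.N_self]
      · rw [hall z hz, one_mul]; rfl
    push_cast at h6
    omega
  -- follow the out-neighbours: `x → y → z` gives `z ≠ x`, and a path `x → z` without its partner
  have hne : Nonempty F := by rw [← Fintype.card_pos_iff]; omega
  have hnext : ∀ x, ∃ y, D.N x y = 1 := by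
    intro x
    by_contra h
    push Not at h
    have : D.dout x = 0 := Finset.sum_eq_zero fun y _ => by
      have := D.N_bit x y; have := h y; omega
    have := hout x
    omega
  have huniq : ∀ x y z, D.N x y = 1 → D.N x z = 1 → y = z := by
    intro x y z hy hz
    by_contra hyz
    have h1 : ∑ w ∈ {y, z}, D.N x w ≤ D.dout x :=
      Finset.sum_le_sum_of_subset_of_nonneg (Finset.subset_univ _) fun _ _ _ => D.N_nonneg _ _
    rw [Finset.sum_pair hyz, hy, hz, hout] at h1
    omega
  obtain ⟨x⟩ := hne
  obtain ⟨y, hy⟩ := hnext x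
  obtain ⟨z, hz⟩ := hnext y
  have hp : D.pathsN x z = 1 := by
    rw [pathsN, Finset.sum_eq_single y, hy, hz, one_mul]
    · intro w _ hw
      have : D.N x w = 0 := by
        rcases D.N_bit x w with h | h
        · exact h
        · exact absurd (huniq _ _ _ h hy) hw
      rw [this, zero_mul]
    · simp
  have hyz : y ≠ z := by
    intro h; rw [h, D.N_self] at hz; omega
  by_cases hxz : x = z
  · have := D.pathsN_self x
    rw [hxz] at this hp
    rw [hp] at this
    push_cast at this
    omega
  · have h1 := D.pathsN_of_ne hxz
    have h2 : D.N x z = 0 := by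
      rcases D.N_bit x z with h | h
      · exact h
      · exact absurd (huniq _ _ _ hy h) hyz
    rw [hp, h2] at h1
    push_cast at h1
    omega

end Involution

end OrbitData

/-! ### An equation in the group ring of the cyclic group of order eleven -/

section Cyclic

/-- The values `∑ i ∈ S, x ^ i`, where `S` runs through the `k`-element subsets of `{0, …, n - 1}`. -/
def subsetPowSums (x : ℕ) : ℕ → ℕ → List ℕ
  | 0, 0 => [0]
  | 0, _ + 1 => []
  | n + 1, 0 => subsetPowSums x n 0
  | n + 1, k + 1 => subsetPowSums x n (k + 1) ++ (subsetPowSums x n k).map (· + x ^ n)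

/-- Completeness of `subsetPowSums`. -/
theorem exists_mem_subsetPowSums (x : ℕ) {f : ℕ → ℤ} (hf : ∀ i, f i = 0 ∨ f i = 1) (n k : ℕ)
    (h : ∑ i ∈ Finset.range n, f i = k) :
    ∃ B ∈ subsetPowSums x n k, (B : ℤ) = ∑ i ∈ Finset.range n, f i * x ^ i := by
  induction n generalizing k with
  | zero =>
    simp only [Finset.range_zero, Finset.sum_empty] at h
    have : k = 0 := by exact_mod_cast h.symm
    subst this
    exact ⟨0, by simp [subsetPowSums], by simp⟩
  | succ n ih =>
    rw [Finset.sum_range_succ] at h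
    rcases hf n with h0 | h1
    · rw [h0, add_zero] at h
      obtain ⟨B, hB, hB'⟩ := ih k h
      refine ⟨B, ?_, by rw [Finset.sum_range_succ, h0, hB']; ring⟩
      cases k with
      | zero => exact hB
      | succ k => exact List.mem_append_left _ hB
    · cases k with
      | zero =>
        have : 0 ≤ ∑ i ∈ Finset.range n, f i :=
          Finset.sum_nonneg fun i _ => by rcases hf i with h | h <;> omega
        push_cast at h
        omega
      | succ k =>
        obtain ⟨B, hB, hB'⟩ := ih k (by push_cast at h; omega)
        refine ⟨B + x ^ n, List.mem_append_right _ (List.mem_map_of_mem hB), ?_⟩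
        rw [Finset.sum_range_succ, h1, ← hB']; push_cast; ring

theorem sum_zmod_eq_sum_range (n : ℕ) [NeZero n] (f : ZMod n → ℤ) :
    ∑ s, f s = ∑ i ∈ Finset.range n, f (i : ZMod n) := by
  obtain ⟨m, rfl⟩ := Nat.exists_eq_succ_of_ne_zero (NeZero.ne n)
  rw [← Fin.sum_univ_eq_sum_range (fun i => f (i : ZMod (m + 1)))]
  refine Finset.sum_congr rfl fun s _ => ?_
  exact congrArg f (ZMod.natCast_zmod_val (n := m + 1) s).symm

/-- Evaluation at an `n`-th root of unity turns convolution over `ZMod n` into multiplication. -/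
theorem eval_mul_eval {n : ℕ} [NeZero n] {R : Type*} [CommRing R] {x : R} (hx : x ^ n = 1)
    (f g : ZMod n → ℤ) :
    (∑ s, (f s : R) * x ^ s.val) * (∑ t, (g t : R) * x ^ t.val)
      = ∑ t, ((∑ s, f s * g (t - s) : ℤ) : R) * x ^ t.val := by
  have hval : ∀ s t : ZMod n, x ^ (s + t).val = x ^ s.val * x ^ t.val := by
    intro s t
    rw [ZMod.val_add, ← pow_add, ← pow_eq_pow_mod _ hx]
  rw [Finset.sum_mul_sum]
  push_cast
  simp only [Finset.sum_mul]
  rw [Finset.sum_comm (s := Finset.univ) (t := Finset.univ)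
    (f := fun (t s : ZMod n) => (f s : R) * (g (t - s) : R) * x ^ t.val)]
  refine Finset.sum_congr rfl fun s _ => ?_
  rw [← Equiv.sum_comp (Equiv.addLeft s)
    (fun t : ZMod n => (f s : R) * (g (t - s) : R) * x ^ t.val)]
  refine Finset.sum_congr rfl fun t _ => ?_
  simp only [Equiv.coe_addLeft, add_sub_cancel_left, hval]
  ring

/-- A solution of `a ^ 2 + a + b c = 2 + 4 ∑ g` in the group ring of `ZMod 11`, where `a`, `b`, `c`
are indicator functions of sets of sizes `5`, `4`, `4` and `0 ∉ a`. -/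
structure CyclicSolution (a b c : ZMod 11 → ℤ) : Prop where
  a_bit : ∀ s, a s = 0 ∨ a s = 1
  b_bit : ∀ s, b s = 0 ∨ b s = 1
  c_bit : ∀ s, c s = 0 ∨ c s = 1
  a_zero : a 0 = 0
  sum_a : ∑ s, a s = 5
  sum_b : ∑ s, b s = 4
  sum_c : ∑ s, c s = 4
  eqn : ∀ t, ∑ s, a s * a (t - s) + ∑ s, b s * c (t - s) + a t = 4 + if t = 0 then 2 else 0

namespace CyclicSolution

variable {a b c : ZMod 11 → ℤ}

theorem scale (h : CyclicSolution a b c) {u : ZMod 11} (hu : u ≠ 0) :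
    CyclicSolution (fun s => a (u * s)) (fun s => b (u * s)) (fun s => c (u * s)) := by
  have : Fact (Nat.Prime 11) := ⟨by norm_num⟩
  have e : ∀ f : ZMod 11 → ℤ, ∑ s, f (u * s) = ∑ s, f s :=
    fun f => Equiv.sum_comp (Equiv.mulLeft₀ u hu) f
  refine ⟨fun s => h.a_bit _, fun s => h.b_bit _, fun s => h.c_bit _, by simpa using h.a_zero,
    (e a).trans h.sum_a, (e b).trans h.sum_b, (e c).trans h.sum_c, fun t => ?_⟩
  have h1 := h.eqn (u * t)
  have h2 : u * t = 0 ↔ t = 0 := by simp [hu]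
  rw [← e (fun s => a s * a (u * t - s)), ← e (fun s => b s * c (u * t - s))] at h1
  simp only [h2, ← mul_sub] at h1
  exact h1

theorem translate (h : CyclicSolution a b c) (u : ZMod 11) :
    CyclicSolution a (fun s => b (s + u)) (fun s => c (s - u)) := by
  refine ⟨h.a_bit, fun s => h.b_bit _, fun s => h.c_bit _, h.a_zero, h.sum_a,
    (Equiv.sum_comp (Equiv.addRight u) b).trans h.sum_b,
    (Equiv.sum_comp (Equiv.subRight u) c).trans h.sum_c, fun t => ?_⟩
  rw [← h.eqn t, ← Equiv.sum_comp (Equiv.addRight u) (fun s => b s * c (t - s))]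
  congr 2
  refine Finset.sum_congr rfl fun s _ => ?_
  simp only [Equiv.coe_addRight]
  congr 2; ring

theorem sum_eleven (f : ZMod 11 → ℤ) : ∑ s, f s = f 0 + f 1 + f 2 + f 3 + f 4 + f 5 + f 6 + f 7
    + f 8 + f 9 + f 10 := by
  rw [sum_zmod_eq_sum_range]
  simp [Finset.sum_range_succ]

/-- The five pairs `{s, -s}` cannot all be hit evenly by the five elements of `a`. -/
theorem exists_not_neg (h : CyclicSolution a b c) : ∃ u, a u = 1 ∧ a (-u) = 0 := by
  by_contra! hne
  have hs : ∀ s, a (-s) = a s := by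
    intro s
    rcases h.a_bit s with h0 | h0 <;> rcases h.a_bit (-s) with h1 | h1
    · omega
    · exact absurd (by rw [neg_neg]; exact h0) (hne _ h1)
    · exact absurd h1 (hne _ h0)
    · omega
  have h1 := h.sum_a
  rw [sum_eleven, h.a_zero, ← hs 6, ← hs 7, ← hs 8, ← hs 9, ← hs 10,
    show (-6 : ZMod 11) = 5 by decide, show (-7 : ZMod 11) = 4 by decide,
    show (-8 : ZMod 11) = 3 by decide, show (-9 : ZMod 11) = 2 by decide,
    show (-10 : ZMod 11) = 1 by decide] at h1
  omega

/-- The coefficient at the identity of the group ring equation. -/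
theorem pairs_eq (h : CyclicSolution a b c) (h1 : a 1 = 1) (h10 : a 10 = 0) :
    2 * (a 2 * a 9 + a 3 * a 8 + a 4 * a 7 + a 5 * a 6) + ∑ s, b s * c (-s) = 6 := by
  have := h.eqn 0
  simp only [zero_sub] at this
  rw [sum_eleven (fun s => a s * a (-s)), h.a_zero, h1, show (-1 : ZMod 11) = 10 by decide, h10,
    show (-2 : ZMod 11) = 9 by decide, show (-3 : ZMod 11) = 8 by decide,
    show (-4 : ZMod 11) = 7 by decide, show (-5 : ZMod 11) = 6 by decide,
    show (-6 : ZMod 11) = 5 by decide, show (-7 : ZMod 11) = 4 by decide,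
    show (-8 : ZMod 11) = 3 by decide, show (-9 : ZMod 11) = 2 by decide,
    show (-10 : ZMod 11) = 1 by decide, if_pos trivial] at this
  linarith

/-- If `c = -b` then `a ^ 2 + a` is invariant under negation. -/
theorem conv_symm (h : CyclicSolution a b c) (hbc : ∀ s, c (-s) = b s) (t : ZMod 11) :
    ∑ s, a s * a (t - s) + a t = ∑ s, a s * a (-t - s) + a (-t) := by
  have h1 := h.eqn t
  have h2 := h.eqn (-t)
  have h3 : ∑ s, b s * c (t - s) = ∑ s, b s * c (-t - s) := by
    rw [← Equiv.sum_comp (Equiv.addRight t) (fun s => b s * c (t - s))]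
    refine Finset.sum_congr rfl fun s _ => ?_
    simp only [Equiv.coe_addRight]
    rw [show t - (s + t) = -s by ring, hbc, show -t - s = -(s + t) by ring, hbc, mul_comm]
  simp only [neg_eq_zero] at h2
  linarith

theorem mul_le (h : CyclicSolution a b c) (s : ZMod 11) : b s * c (-s) ≤ b s := by
  rcases h.b_bit s with h1 | h1 <;> rcases h.c_bit (-s) with h2 | h2 <;> simp [h1, h2]

/-- If a five-element `a`, containing `1` but neither `0` nor `10`, contains a pair `{s, -s}`, then
`a ^ 2 + a` is not invariant under negation. -/
theorem symm_check : ∀ a2 a3 a4 a5 a6 a7 a8 a9 : Bool,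
    let A : List ℕ := [0, 1, a2.toNat, a3.toNat, a4.toNat, a5.toNat, a6.toNat, a7.toNat, a8.toNat,
      a9.toNat, 0]
    a2.toNat + a3.toNat + a4.toNat + a5.toNat + a6.toNat + a7.toNat + a8.toNat + a9.toNat = 4 →
    (a2 && a9 || a3 && a8 || a4 && a7 || a5 && a6) = true →
    ∃ t ∈ List.range 11,
      ((List.range 11).map fun s => A.getD s 0 * A.getD ((t + 11 - s) % 11) 0).sum + A.getD t 0 ≠
      ((List.range 11).map fun s => A.getD s 0 * A.getD ((22 - t - s) % 11) 0).sum
        + A.getD ((11 - t) % 11) 0 := by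
  decide +kernel

/-- Evaluations at `4` modulo `(4 ^ 11 - 1) / 3` separate the two sides of the equation when `a`
consists of `1` and two pairs `{s, -s}` and `0 ∈ b`. As `4 ^ 0` is the only power of `4` that is not
divisible by `4`, the condition `B % 4 ≠ 0` expresses `0 ∈ b`. -/
theorem eval_check : ∀ e ∈ [(2, 3), (2, 4), (2, 5), (3, 4), (3, 5), (4, 5)],
    ∀ B ∈ subsetPowSums 4 11 4, B % 4 = 0 ∨ ∀ C ∈ subsetPowSums 4 11 4,
    ((4 + 4 ^ e.1 + 4 ^ e.2 + 4 ^ (11 - e.1) + 4 ^ (11 - e.2)) *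
      (4 + 4 ^ e.1 + 4 ^ e.2 + 4 ^ (11 - e.1) + 4 ^ (11 - e.2) + 1) + B * C) % 1398101 ≠ 2 := by
  decide +kernel

/-- If `a` contains exactly one pair `{s, -s}`, then the coefficient at the identity gives `c = -b`,
which makes `a ^ 2 + a` invariant under negation. -/
theorem pairs_ne_one (h : CyclicSolution a b c) (h1 : a 1 = 1) (h10 : a 10 = 0) :
    a 2 * a 9 + a 3 * a 8 + a 4 * a 7 + a 5 * a 6 ≠ 1 := by
  intro hP
  have hpairs := h.pairs_eq h1 h10
  have hsum := h.sum_a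
  rw [sum_eleven, h.a_zero, h1, h10] at hsum
  have hb4 : ∑ s, b s * c (-s) = ∑ s, b s := by rw [h.sum_b]; omega
  have hb1 : ∀ s, b s * c (-s) = b s := fun s =>
    (Finset.sum_eq_sum_iff_of_le fun s _ => h.mul_le s).mp hb4 s (Finset.mem_univ s)
  have hble : ∀ s, b s ≤ c (-s) := fun s => by
    have := hb1 s
    rcases h.b_bit s with h2 | h2 <;> rcases h.c_bit (-s) with h3 | h3 <;> simp_all
  have hb5 : ∑ s, b s = ∑ s, c (-s) := by
    rw [h.sum_b, ← h.sum_c]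
    exact (Equiv.sum_comp (Equiv.neg (ZMod 11)) c).symm
  have hb2 : ∀ s, c (-s) = b s := fun s =>
    ((Finset.sum_eq_sum_iff_of_le fun s _ => hble s).mp hb5 s (Finset.mem_univ s)).symm
  have hsymm := h.conv_symm hb2
  have hbit : ∀ s, ∃ β : Bool, a s = β.toNat := fun s => by
    rcases h.a_bit s with h | h
    · exact ⟨false, by simpa using h⟩
    · exact ⟨true, by simpa using h⟩
  obtain ⟨b2, e2⟩ := hbit 2
  obtain ⟨b3, e3⟩ := hbit 3
  obtain ⟨b4, e4⟩ := hbit 4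
  obtain ⟨b5, e5⟩ := hbit 5
  obtain ⟨b6, e6⟩ := hbit 6
  obtain ⟨b7, e7⟩ := hbit 7
  obtain ⟨b8, e8⟩ := hbit 8
  obtain ⟨b9, e9⟩ := hbit 9
  obtain ⟨t, ht, hne⟩ := symm_check b2 b3 b4 b5 b6 b7 b8 b9
    (by rw [e2, e3, e4, e5, e6, e7, e8, e9] at hsum; omega)
    (by
      rw [e2, e3, e4, e5, e6, e7, e8, e9] at hP
      clear * - hP
      revert hP
      revert b2 b3 b4 b5 b6 b7 b8 b9
      decide)
  apply hne
  have hA : ∀ s : ℕ, s < 11 → a (s : ZMod 11) = (([0, 1, b2.toNat, b3.toNat, b4.toNat, b5.toNat,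
      b6.toNat, b7.toNat, b8.toNat, b9.toNat, 0] : List ℕ).getD s 0 : ℤ) := by
    intro s hs
    interval_cases s <;> simp_all [h.a_zero]
  have ht' : t < 11 := List.mem_range.mp ht
  have hs := hsymm (t : ZMod 11)
  rw [sum_zmod_eq_sum_range, sum_zmod_eq_sum_range] at hs
  have hsub : ∀ s : ℕ, s < 11 → (t : ZMod 11) - (s : ZMod 11) = ((t + 11 - s) % 11 : ℕ) := by
    intro s hs
    rw [ZMod.natCast_mod, Nat.cast_sub (by omega)]
    push_cast
    rw [show (11 : ZMod 11) = 0 by rfl, add_zero]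
  have hneg : -(t : ZMod 11) = ((11 - t) % 11 : ℕ) := by
    rw [ZMod.natCast_mod, Nat.cast_sub (by omega)]
    push_cast
    rw [show (11 : ZMod 11) = 0 by rfl, zero_sub]
  have hsub' : ∀ s : ℕ, s < 11 → -(t : ZMod 11) - (s : ZMod 11) = ((22 - t - s) % 11 : ℕ) := by
    intro s hs
    rw [ZMod.natCast_mod, Nat.cast_sub (by omega), Nat.cast_sub (by omega)]
    push_cast
    rw [show (22 : ZMod 11) = 0 by rfl, zero_sub]
  have hl : ∀ f : ℕ → ℕ, ((List.range 11).map f).sum = ∑ s ∈ Finset.range 11, f s := by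
    intro f
    simp [List.range_succ, Finset.sum_range_succ, add_assoc]
  rw [hl, hl]
  zify
  rw [← hA t ht', ← hA _ (Nat.mod_lt _ (by norm_num)), ← hneg]
  refine Eq.trans ?_ (hs.trans ?_) <;> congr 1 <;> refine Finset.sum_congr rfl fun s hs => ?_
  · rw [hsub s (Finset.mem_range.mp hs), hA s (Finset.mem_range.mp hs),
      hA _ (Nat.mod_lt _ (by norm_num))]
  · rw [hsub' s (Finset.mem_range.mp hs), hA s (Finset.mem_range.mp hs),
      hA _ (Nat.mod_lt _ (by norm_num))]

/-- Evaluating the group ring relation at a root of unity `x` modulo `M` with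
`1 + x + ⋯ + x ^ 10 = 0`. -/
theorem dvd_eval (h : CyclicSolution a b c) (M x : ℕ) (hx : (x : ZMod M) ^ 11 = 1)
    (hx' : ∑ i ∈ Finset.range 11, (x : ZMod M) ^ i = 0) :
    (M : ℤ) ∣ (∑ i ∈ Finset.range 11, a (i : ZMod 11) * (x : ℤ) ^ i) *
      (∑ i ∈ Finset.range 11, a (i : ZMod 11) * (x : ℤ) ^ i + 1) +
      (∑ i ∈ Finset.range 11, b (i : ZMod 11) * (x : ℤ) ^ i) *
      (∑ i ∈ Finset.range 11, c (i : ZMod 11) * (x : ℤ) ^ i) - 2 := by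
  have hext : ∀ f : ZMod 11 → ℤ, ∑ s, (f s : ZMod M) * (x : ZMod M) ^ s.val
      = ((∑ i ∈ Finset.range 11, f (i : ZMod 11) * (x : ℤ) ^ i : ℤ) : ZMod M) := by
    intro f
    have e := sum_zmod_eq_sum_range 11 (fun s => f s * (x : ℤ) ^ s.val)
    have : ∑ i ∈ Finset.range 11, f (i : ZMod 11) * (x : ℤ) ^ ((i : ZMod 11)).val
        = ∑ i ∈ Finset.range 11, f (i : ZMod 11) * (x : ℤ) ^ i :=
      Finset.sum_congr rfl fun i hi => by
        rw [ZMod.val_natCast_of_lt (Finset.mem_range.mp hi)]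
    rw [← this, ← e]
    push_cast
    rfl
  have hev := eval_mul_eval hx a a
  have hev' := eval_mul_eval hx b c
  have hrel : ∑ t : ZMod 11, ((∑ s, a s * a (t - s) + ∑ s, b s * c (t - s) + a t : ℤ) : ZMod M)
      * (x : ZMod M) ^ t.val = 2 := by
    have e : ∀ t : ZMod 11, ((4 + if t = 0 then 2 else 0 : ℤ) : ZMod M) * (x : ZMod M) ^ t.val
        = 4 * ((1 : ℤ) * (x : ZMod M) ^ t.val) + if t = 0 then 2 else 0 := by
      intro t
      by_cases ht : t = 0
      · subst ht; norm_num
      · simp [ht]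
    rw [Finset.sum_congr rfl fun t _ => by rw [h.eqn t, e t], Finset.sum_add_distrib,
      ← Finset.mul_sum, hext (fun _ => 1)]
    push_cast
    simp only [one_mul, hx', mul_zero, zero_add, Finset.sum_ite_eq', Finset.mem_univ, if_true]
  simp only [Int.cast_add, add_mul, Finset.sum_add_distrib] at hrel
  rw [← hev, ← hev', hext a, hext b, hext c] at hrel
  rw [← ZMod.intCast_zmod_eq_zero_iff_dvd]
  rw [← sub_eq_zero] at hrel
  rw [← hrel]
  push_cast
  ring

/-- After normalizing, `a` contains `1` but not `-1`, and two pairs `{s, -s}`; evaluation at a root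
of unity then excludes the equation. -/
theorem false_of_normalized (h : CyclicSolution a b c) (h1 : a 1 = 1) (h10 : a 10 = 0) (hb : b 0 = 1) :
    False := by
  have hpairs := h.pairs_eq h1 h10
  have hbc : ∑ s, b s * c (-s) ≤ 4 := by
    rw [← h.sum_b]; exact Finset.sum_le_sum fun s _ => h.mul_le s
  have hP := h.pairs_ne_one h1 h10
  have hsum := h.sum_a
  rw [sum_eleven, h.a_zero, h1, h10] at hsum
  have hprod : ∀ s t, (a s = 1 ∧ a t = 1 ∧ a s * a t = 1) ∨
      (a s * a t = 0 ∧ a s + a t ≤ 1 ∧ 0 ≤ a s ∧ 0 ≤ a t) := by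
    intro s t
    rcases h.a_bit s with h2 | h2 <;> rcases h.a_bit t with h3 | h3 <;> simp [h2, h3]
  have p2 := hprod 2 9
  have p3 := hprod 3 8
  have p4 := hprod 4 7
  have p5 := hprod 5 6
  have hxN : ((4 ^ 11 : ℕ) : ZMod 1398101) = (1 : ℕ) := by
    rw [ZMod.natCast_eq_natCast_iff']
    norm_num
  have hxS : ((∑ i ∈ Finset.range 11, 4 ^ i : ℕ) : ZMod 1398101) = 0 := by
    rw [ZMod.natCast_eq_zero_iff]
    decide
  have hdvd := h.dvd_eval 1398101 4 (by push_cast at hxN; exact_mod_cast hxN)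
    (by rw [← hxS]; push_cast; rfl)
  obtain ⟨B, hB, hB'⟩ := exists_mem_subsetPowSums 4 (f := fun i => b (i : ZMod 11))
    (fun i => h.b_bit _) 11 4 (by rw [← sum_zmod_eq_sum_range 11 b]; exact h.sum_b)
  obtain ⟨C, hC, hC'⟩ := exists_mem_subsetPowSums 4 (f := fun i => c (i : ZMod 11))
    (fun i => h.c_bit _) 11 4 (by rw [← sum_zmod_eq_sum_range 11 c]; exact h.sum_c)
  have hB4 : B % 4 ≠ 0 := by
    rw [Finset.sum_range_succ'] at hB'
    simp only [Nat.cast_zero, hb, pow_zero, mul_one, pow_succ, ← mul_assoc,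
      ← Finset.sum_mul] at hB'
    push_cast at hB'
    omega
  have hA : ∑ i ∈ Finset.range 11, a (i : ZMod 11) * ((4 : ℕ) : ℤ) ^ i = 4 + a 2 * 4 ^ 2
      + a 3 * 4 ^ 3 + a 4 * 4 ^ 4 + a 5 * 4 ^ 5 + a 6 * 4 ^ 6 + a 7 * 4 ^ 7 + a 8 * 4 ^ 8
      + a 9 * 4 ^ 9 := by
    simp [Finset.sum_range_succ, h.a_zero, h1, h10]
  rw [← hB', ← hC', hA] at hdvd
  -- `a` consists of `1` and two of the pairs `{2, 9}`, `{3, 8}`, `{4, 7}`, `{5, 6}`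
  have hfin : ∀ e ∈ [(2, 3), (2, 4), (2, 5), (3, 4), (3, 5), (4, 5)],
      (4 + a 2 * 4 ^ 2 + a 3 * 4 ^ 3 + a 4 * 4 ^ 4 + a 5 * 4 ^ 5 + a 6 * 4 ^ 6 + a 7 * 4 ^ 7
        + a 8 * 4 ^ 8 + a 9 * 4 ^ 9 : ℤ)
        ≠ ((4 + 4 ^ e.1 + 4 ^ e.2 + 4 ^ (11 - e.1) + 4 ^ (11 - e.2) : ℕ) : ℤ) := by
    intro e he hA
    rw [hA] at hdvd
    rcases eval_check e he B hB with h0 | h0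
    · exact hB4 h0
    · apply h0 C hC
      generalize 4 + 4 ^ e.1 + 4 ^ e.2 + 4 ^ (11 - e.1) + 4 ^ (11 - e.2) = A at hdvd ⊢
      have : (((A * (A + 1) + B * C : ℕ) : ℤ) - 2) % 1398101 = 0 := by
        rw [← Int.dvd_iff_emod_eq_zero]; push_cast; exact hdvd
      generalize A * (A + 1) + B * C = Z at this ⊢
      omega
  simp only [List.mem_cons, List.not_mem_nil, or_false, forall_eq_or_imp, forall_eq] at hfin
  norm_num at hfin
  omega

/-- A unit of `ZMod 11` and a translation normalize a solution so that `1 ∈ a`, `-1 ∉ a` and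
`0 ∈ b`. -/
protected theorem false (h : CyclicSolution a b c) : False := by
  obtain ⟨u, hu, hu'⟩ := h.exists_not_neg
  have hu0 : u ≠ 0 := by
    rintro rfl
    rw [h.a_zero] at hu
    omega
  have h1 := h.scale hu0
  obtain ⟨v, hv⟩ : ∃ v, b (u * v) = 1 := by
    by_contra! hne
    have := h1.sum_b
    rw [Finset.sum_eq_zero fun s _ => (h1.b_bit s).resolve_right (hne s)] at this
    omega
  refine (h1.translate v).false_of_normalized ?_ ?_ ?_
  · simpa using hu
  · rw [show (10 : ZMod 11) = -1 by decide, mul_neg_one]; exact hu'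
  · simpa using hv

end CyclicSolution

end Cyclic

namespace OrbitData

/-- With two orbits of length `11` and no fixed points, counting degrees and paths determines the
sizes of the blocks. -/
theorem false_of_eleven {F ι : Type*} [Fintype F] [Fintype ι] [DecidableEq F] [DecidableEq ι]
    [IsEmpty F] (D : OrbitData 11 F ι) (hι : Fintype.card ι = 2) : False := by
  have e := Fintype.equivFinOfCardEq hι
  let E := D.reindex e.symm
  have hout := E.out_orbit
  have hin := E.in_orbit
  have hsq := E.sq_orbit_orbit
  simp only [Finset.univ_eq_empty, Finset.sum_empty, zero_add, Fin.sum_univ_two] at hout hin hsq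
  have o0 := hout 0
  have o1 := hout 1
  have i0 := hin 0
  have h00 : ∀ f g : ZMod 11 → ℤ, ∑ t, ∑ s, f s * g (t - s) = (∑ s, f s) * ∑ s, g s := by
    intro f g
    rw [Finset.sum_comm, Finset.sum_mul]
    refine Finset.sum_congr rfl fun s _ => ?_
    rw [← Finset.mul_sum]
    congr 1
    exact Equiv.sum_comp (Equiv.subRight s) g
  have htot := Finset.sum_congr rfl fun (t : ZMod 11) (_ : t ∈ Finset.univ) => hsq 0 1 t
  simp only [Finset.sum_add_distrib, h00, Fin.zero_ne_one, false_and, if_false] at htot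
  simp only [Finset.sum_const, Finset.card_univ, ZMod.card, nsmul_eq_mul] at htot
  have ha := E.r_nonneg 0 0
  have ha' : E.r 0 0 ≤ 9 := by
    have := E.r_nonneg 0 1
    unfold r at *
    omega
  have hsize : E.r 0 0 = 5 ∧ E.r 0 1 = 4 ∧ E.r 1 0 = 4 := by
    unfold r at *
    generalize ∑ s, E.b 0 0 s = x at *
    have y1 : ∑ s, E.b 0 1 s = 9 - x := by omega
    have y2 : ∑ s, E.b 1 0 s = 9 - x := by omega
    have y3 : ∑ s, E.b 1 1 s = x := by omega
    rw [y1, y3] at htot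
    push_cast at htot
    rw [y1, y2]
    interval_cases x <;> omega
  refine CyclicSolution.false (a := E.b 0 0) (b := E.b 0 1) (c := E.b 1 0)
    ⟨E.b_bit _ _, E.b_bit _ _, E.b_bit _ _, E.b_self 0, hsize.1, hsize.2.1, hsize.2.2, fun t => ?_⟩
  have := hsq 0 0 t
  simpa using this

end OrbitData

/-! ### Block sizes and automorphisms of order three -/

namespace OrbitData

variable {F ι : Type*} [Fintype F] [Fintype ι] [DecidableEq F] [DecidableEq ι]

theorem sum_W_add_sum_r {p : ℕ} [NeZero p] (D : OrbitData p F ι) (j : ι) :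
    ∑ z, D.W z j + ∑ i, D.r i j = 9 := D.in_orbit j

theorem sum_N_mul_W {p : ℕ} [NeZero p] (D : OrbitData p F ι) (x : F) (j : ι) :
    ∑ z, D.N x z * D.W z j + ∑ i, D.W x i * D.r i j + D.W x j = 4 := D.sq_fixed_orbit x j

theorem sum_U_mul_N {p : ℕ} [NeZero p] (D : OrbitData p F ι) (i : ι) (y : F) :
    ∑ z, D.U i z * D.N z y + ∑ k, D.r i k * D.U k y + D.U i y = 4 := D.sq_orbit_fixed i y

/-- The equation between orbits, summed over a block: the matrix of block sizes satisfies a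
quadratic equation. -/
theorem r_sq {p : ℕ} [NeZero p] (D : OrbitData p F ι) (i j : ι) :
    p * ∑ z, D.U i z * D.W z j + ∑ k, D.r i k * D.r k j + D.r i j
      = 4 * p + if i = j then 2 else 0 := by
  have h := Finset.sum_congr rfl fun (t : ZMod p) (_ : t ∈ Finset.univ) => D.sq_orbit_orbit i j t
  have h1 : ∑ t : ZMod p, ∑ k, ∑ s, D.b i k s * D.b k j (t - s) = ∑ k, D.r i k * D.r k j := by
    rw [Finset.sum_comm]
    refine Finset.sum_congr rfl fun k _ => ?_
    rw [Finset.sum_comm, r, Finset.sum_mul]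
    refine Finset.sum_congr rfl fun s _ => ?_
    rw [← Finset.mul_sum]
    congr 1
    exact Equiv.sum_comp (Equiv.subRight s) (D.b k j)
  simp only [Finset.sum_add_distrib, h1, ite_and] at h
  simp only [Finset.sum_const, Finset.card_univ, ZMod.card, nsmul_eq_mul] at h
  rw [r, h]
  by_cases hij : i = j <;> simp [hij, mul_comm]

/-- Twice the real part of the product of the character sums of the blocks `b i k` and `b k i`
at a primitive cube root of unity. -/
def crossTerm (D : OrbitData 3 F ι) (i k : ι) : ℤ :=
  2 * ∑ s, D.b i k s * D.b k i (0 - s) - ∑ s, D.b i k s * D.b k i (1 - s)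
    - ∑ s, D.b i k s * D.b k i (2 - s)

theorem r_three (D : OrbitData 3 F ι) (i k : ι) :
    D.r i k = D.b i k 0 + D.b i k 1 + D.b i k 2 := Fin.sum_univ_three (D.b i k)

theorem crossTerm_eq (D : OrbitData 3 F ι) (i k : ι) : D.crossTerm i k =
    2 * (D.b i k 0 * D.b k i 0 + D.b i k 1 * D.b k i 2 + D.b i k 2 * D.b k i 1)
    - (D.b i k 0 * D.b k i 1 + D.b i k 1 * D.b k i 0 + D.b i k 2 * D.b k i 2)
    - (D.b i k 0 * D.b k i 2 + D.b i k 1 * D.b k i 1 + D.b i k 2 * D.b k i 0) := by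
  have hu : ∀ f : ZMod 3 → ℤ, ∑ s, f s = f 0 + f 1 + f 2 := fun f => Fin.sum_univ_three f
  rw [crossTerm, hu, hu, hu, show (0 - 0 : ZMod 3) = 0 by decide, show (0 - 1 : ZMod 3) = 2 by decide,
    show (0 - 2 : ZMod 3) = 1 by decide, show (1 - 0 : ZMod 3) = 1 by decide,
    show (1 - 1 : ZMod 3) = 0 by decide, show (1 - 2 : ZMod 3) = 2 by decide,
    show (2 - 0 : ZMod 3) = 2 by decide, show (2 - 1 : ZMod 3) = 1 by decide,
    show (2 - 2 : ZMod 3) = 0 by decide]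

/-- The cross term is bounded because the character sums of subsets of `ZMod 3` are zero or units of
the Eisenstein integers. -/
theorem crossTerm_cases (D : OrbitData 3 F ι) (i k : ι) : D.crossTerm i k ≤ 2 ∧
    (0 < D.crossTerm i k → (D.r i k = 1 ∨ D.r i k = 2) ∧ (D.r k i = 1 ∨ D.r k i = 2)) ∧
    (D.crossTerm i k = 2 → D.r i k = D.r k i) := by
  rw [crossTerm_eq, r_three, r_three]
  rcases D.b_bit i k 0 with h1 | h1 <;> rcases D.b_bit i k 1 with h2 | h2 <;>
  rcases D.b_bit i k 2 with h3 | h3 <;> rcases D.b_bit k i 0 with h4 | h4 <;>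
  rcases D.b_bit k i 1 with h5 | h5 <;> rcases D.b_bit k i 2 with h6 | h6 <;>
  rw [h1, h2, h3, h4, h5, h6] <;> norm_num

theorem crossTerm_self (D : OrbitData 3 F ι) (i : ι) :
    (D.r i i = 0 ∧ D.crossTerm i i = 0) ∨ (D.r i i = 1 ∧ D.crossTerm i i = -1) ∨
    (D.r i i = 2 ∧ D.crossTerm i i = 2) := by
  rw [crossTerm_eq, r_three, D.b_self]
  rcases D.b_bit i i 1 with h1 | h1 <;> rcases D.b_bit i i 2 with h2 | h2 <;>
  rw [h1, h2] <;> norm_num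

theorem sum_crossTerm (D : OrbitData 3 F ι) (i : ι) : ∑ k, D.crossTerm i k = 4 + D.r i i := by
  have h0 := D.sq_orbit_orbit i i 0
  have h1 := D.sq_orbit_orbit i i 1
  have h2 := D.sq_orbit_orbit i i 2
  rw [if_pos ⟨rfl, rfl⟩] at h0
  rw [if_neg (fun h => absurd h.2 (by decide))] at h1 h2
  simp only [crossTerm, Finset.sum_sub_distrib, ← Finset.mul_sum]
  rw [r_three]
  have := D.b_self i
  linarith

/-- By `crossTerm_self` the cross terms of `i` with the other orbits add up to at least four, and
each of them is at most two. -/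
theorem three_le_card_of_three (D : OrbitData 3 F ι) (i : ι) : 3 ≤ Fintype.card ι := by
  have h := D.sum_crossTerm i
  rw [← Finset.add_sum_erase _ _ (Finset.mem_univ i)] at h
  have hle : ∑ k ∈ Finset.univ.erase i, D.crossTerm i k ≤ ∑ k ∈ Finset.univ.erase i, (2 : ℤ) :=
    Finset.sum_le_sum fun k _ => (D.crossTerm_cases i k).1
  have hc : 0 < Fintype.card ι := Fintype.card_pos_iff.mpr ⟨i⟩
  simp only [Finset.sum_const, Finset.card_erase_of_mem (Finset.mem_univ i), Finset.card_univ,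
    nsmul_eq_mul] at hle
  rw [Nat.cast_sub hc] at hle
  have := D.crossTerm_self i
  push_cast at hle
  omega

/-! ### Degrees within the fixed points -/

section FixedDegrees

variable (D : OrbitData 3 F ι)

theorem dout_cases (x : F) : D.dout x + 3 * ∑ i, D.W x i = 9 := by
  have := D.dout_eq x
  push_cast at this
  exact this

theorem pathsN_of_ne' {x y : F} (h : x ≠ y) : D.pathsN x y + 3 * D.K x y + D.N x y = 4 := by
  have := D.pathsN_of_ne h
  push_cast at this
  exact this

theorem pathsN_self' (x : F) : D.pathsN x x + 3 * D.K x x = 6 := by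
  have := D.pathsN_self x
  push_cast at this
  exact this

theorem dout_ne_zero (hF : 2 ≤ Fintype.card F) (x : F) : D.dout x ≠ 0 := by
  intro h
  obtain ⟨y, hy⟩ := Fintype.exists_ne_of_one_lt_card hF x
  have h1 := D.pathsN_of_ne' hy.symm
  have h2 := D.pathsN_add_N_le_dout x y
  have h3 := D.pathsN_nonneg x y
  have h4 := D.N_nonneg x y
  omega

/-- If a fixed point is joined to all others, then the two-step paths to `z` are counted by the
in-degree of `z`, which is divisible by three. -/
theorem dout_add_one_ne (hF : 2 ≤ Fintype.card F) (x : F) : D.dout x + 1 ≠ Fintype.card F := by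
  intro h
  obtain ⟨z, hz⟩ := Fintype.exists_ne_of_one_lt_card hF x
  have h1 := D.pathsN_of_ne' hz.symm
  have h2 := D.rev.dout_cases z
  have h3 : D.pathsN x z + D.N x z = D.rev.dout z := by
    have e : D.N x z = ∑ w, if w = x then D.N x z else 0 := by simp
    rw [e, pathsN, ← Finset.sum_add_distrib]
    refine Finset.sum_congr rfl fun w _ => ?_
    by_cases hw : w = x
    · subst hw; simp [D.N_self, rev]
    · simp [hw, D.N_eq_one_of_dout h hw, rev]
  rw [D.N_eq_one_of_dout h hz] at h1 h3
  omega

theorem pathsN_of_dout_three {x y : F} (hx : D.dout x = 3) (hy : y ≠ x) :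
    D.pathsN x y = 1 - D.N x y ∧ D.K x y = 1 := by
  have h1 := D.pathsN_of_ne' hy.symm
  have h2 := D.pathsN_add_N_le_dout x y
  have h3 := D.pathsN_nonneg x y
  have h4 := D.N_bit x y
  omega

theorem pathsN_self_of_dout_three {x : F} (hx : D.dout x = 3) :
    (D.pathsN x x = 0 ∧ D.K x x = 2) ∨ (D.pathsN x x = 3 ∧ D.K x x = 1) := by
  have h1 := D.pathsN_self' x
  have h2 := D.pathsN_le_dout x x
  have h3 := D.pathsN_nonneg x x
  omega

theorem sum_dout_of_dout_three {x : F} (hx : D.dout x = 3) :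
    ∑ z, D.N x z * D.dout z = D.pathsN x x + Fintype.card F - 4 := by
  rw [← D.sum_pathsN]
  have h1 : ∀ y, D.pathsN x y = (1 - D.N x y) + if y = x then D.pathsN x x - 1 else 0 := by
    intro y
    by_cases hy : y = x
    · subst hy; simp [D.N_self]
    · simp [hy, (D.pathsN_of_dout_three hx hy).1]
  have h2 : ∑ y, D.N x y = 3 := hx
  rw [Finset.sum_congr rfl fun y _ => h1 y, Finset.sum_add_distrib, Finset.sum_sub_distrib, h2]
  simp
  ring

theorem card_ne_four_of_three (D : OrbitData 3 F ι) : Fintype.card F ≠ 4 := by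
  intro hF
  have hne : Nonempty F := by rw [← Fintype.card_pos_iff]; omega
  obtain ⟨x⟩ := hne
  have := D.dout_ne_zero (by omega) x
  have := D.dout_add_one_ne (by omega) x
  have := D.dout_cases x
  have := D.dout_add_one_le x
  have := D.dout_nonneg x
  omega

/-- All out-degrees are three, so nine two-step paths within the fixed points leave each of them, while
the equation allows at most six. -/
theorem card_ne_seven_of_three (D : OrbitData 3 F ι) : Fintype.card F ≠ 7 := by
  intro hF
  have h3 : ∀ x, D.dout x = 3 := by
    intro x
    have := D.dout_ne_zero (by omega) x
    have := D.dout_add_one_ne (by omega) x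
    have := D.dout_cases x
    have := D.dout_add_one_le x
    have := D.dout_nonneg x
    omega
  have hne : Nonempty F := by rw [← Fintype.card_pos_iff]; omega
  obtain ⟨x⟩ := hne
  have h := D.sum_dout_of_dout_three (h3 x)
  simp only [h3, ← Finset.sum_mul] at h
  have h2 : ∑ y, D.N x y = 3 := h3 x
  rw [h2] at h
  have := D.pathsN_self_of_dout_three (h3 x)
  omega

end FixedDegrees

/-! ### Ten fixed points form a Petersen graph -/

section Ten

variable (D : OrbitData 3 F ι)

theorem dout_of_card_ten (hF : Fintype.card F = 10) (x : F) : D.dout x = 3 ∨ D.dout x = 6 := by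
  have := D.dout_ne_zero (by omega) x
  have := D.dout_add_one_ne (by omega) x
  have := D.dout_cases x
  have := D.dout_add_one_le x
  have := D.dout_nonneg x
  omega

/-- At least nine paths leave a fixed point of out-degree three. This is just what `pathsN_self`
allows, so its three edges are reciprocal and lead to vertices of out-degree three. -/
theorem neighbours_of_dout_three (hF : Fintype.card F = 10) {x : F} (hx : D.dout x = 3) :
    D.pathsN x x = 3 ∧ ∀ z, D.N x z = 1 → D.dout z = 3 := by
  have h := D.sum_dout_of_dout_three hx
  have h1 := D.pathsN_self_of_dout_three hx
  have h2 : ∑ y, D.N x y = 3 := hx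
  have hnn : ∀ z ∈ Finset.univ, 0 ≤ D.N x z * (D.dout z - 3) := fun z _ =>
    mul_nonneg (D.N_nonneg _ _) (by have := D.dout_of_card_ten hF z; omega)
  have h3 : ∑ z, D.N x z * (D.dout z - 3) = D.pathsN x x - 3 := by
    simp only [mul_sub, Finset.sum_sub_distrib, ← Finset.sum_mul, h2, h, hF]
    push_cast; ring
  have h4 := Finset.sum_nonneg hnn
  have h5 : D.pathsN x x = 3 := by omega
  refine ⟨h5, fun z hz => ?_⟩
  rw [h5, sub_self, Finset.sum_eq_zero_iff_of_nonneg hnn] at h3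
  have := h3 z (Finset.mem_univ z)
  rw [hz, one_mul] at this
  omega

/-- If one fixed point has out-degree three, then the fixed points form a Petersen graph. -/
theorem petersen_of_dout_three (hF : Fintype.card F = 10) {x : F} (hx : D.dout x = 3) :
    (∀ y, D.dout y = 3) ∧ (∀ y z, D.N y z = D.N z y) ∧ ∀ y z, D.K y z = 1 := by
  have hall : ∀ y, D.dout y = 3 := by
    intro y
    by_cases hy : y = x
    · rw [hy, hx]
    · have h1 := (D.pathsN_of_dout_three hx hy).1
      rcases D.N_bit x y with h | h
      · have h2 : ∃ z, D.N x z * D.N z y ≠ 0 := by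
          by_contra! h0
          have : D.pathsN x y = 0 := Finset.sum_eq_zero fun z _ => h0 z
          omega
        obtain ⟨z, hz⟩ := h2
        have hz1 := D.N_bit x z
        have hz2 := D.N_bit z y
        have hxz : D.N x z = 1 := hz1.resolve_left (left_ne_zero_of_mul hz)
        have hzy : D.N z y = 1 := hz2.resolve_left (right_ne_zero_of_mul hz)
        exact (D.neighbours_of_dout_three hF
          ((D.neighbours_of_dout_three hF hx).2 z hxz)).2 y hzy
      · exact (D.neighbours_of_dout_three hF hx).2 y h
  have himp : ∀ y z, D.N y z = 1 → D.N z y = 1 := by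
    intro y z hyz
    have h1 := (D.neighbours_of_dout_three hF (hall y)).1
    rw [← hall y, pathsN, dout] at h1
    have h2 := (Finset.sum_eq_sum_iff_of_le fun w _ =>
      mul_le_of_le_one_right (D.N_nonneg y w) (D.N_le_one w y)).mp h1 z (Finset.mem_univ z)
    rwa [hyz, one_mul] at h2
  refine ⟨hall, fun y z => ?_, fun y z => ?_⟩
  · rcases D.N_bit y z with h | h
    · rcases D.N_bit z y with h' | h'
      · rw [h, h']
      · have := himp _ _ h'; omega
    · rw [h, himp _ _ h]
  · by_cases hyz : z = y
    · subst hyz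
      have h1 := (D.neighbours_of_dout_three hF (hall z)).1
      have := D.pathsN_self' z
      omega
    · exact (D.pathsN_of_dout_three (hall y) hyz).2

/-- With all degrees six on ten fixed points, any two fixed points have so many common neighbours
that no path between them passes through an orbit. -/
theorem K_eq_zero_of_dout_six (hF : Fintype.card F = 10) (h6 : ∀ x, D.dout x = 6)
    (h6' : ∀ x, D.rev.dout x = 6) (x y : F) : D.K x y = 0 := by
  have hexp : ∀ y, ∑ z, (1 - D.N x z) * (1 - D.N z y) = D.pathsN x y - 2 := by
    intro y
    have e1 : ∑ z, D.N x z = 6 := h6 x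
    have e2 : ∑ z, D.N z y = 6 := h6' y
    have : ∀ z, (1 - D.N x z) * (1 - D.N z y) = 1 - D.N x z - D.N z y + D.N x z * D.N z y :=
      fun z => by ring
    simp only [this, Finset.sum_add_distrib, Finset.sum_sub_distrib, e1, e2, pathsN]
    simp [hF]
    ring
  have hnn : ∀ y z, 0 ≤ (1 - D.N x z) * (1 - D.N z y) := fun y z =>
    mul_nonneg (by linarith [D.N_le_one x z]) (by linarith [D.N_le_one z y])
  have hne : ∀ y, y ≠ x → D.K x y = 0 ∧ D.pathsN x y = 4 - D.N x y := by
    intro y hy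
    have h1 : ∑ z ∈ {x, y}, (1 - D.N x z) * (1 - D.N z y)
        ≤ ∑ z, (1 - D.N x z) * (1 - D.N z y) :=
      Finset.sum_le_sum_of_subset_of_nonneg (Finset.subset_univ _) fun z _ _ => hnn y z
    rw [Finset.sum_pair hy.symm, hexp, D.N_self, D.N_self] at h1
    have h2 := D.pathsN_of_ne' hy.symm
    have h3 := D.N_bit x y
    have h4 := D.K_nonneg x y
    omega
  by_cases hy : y = x
  · subst hy
    have h1 : ∀ z, D.pathsN y z = (4 - D.N y z) + if z = y then D.pathsN y y - 4 else 0 := by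
      intro z
      by_cases hz : z = y
      · subst hz; simp [D.N_self]
      · simp [hz, (hne z hz).2]
    have h2 := D.sum_pathsN y
    have e1 : ∑ z, D.N y z = 6 := h6 y
    simp only [h6, ← Finset.sum_mul, e1] at h2
    rw [Finset.sum_congr rfl fun z _ => h1 z, Finset.sum_add_distrib, Finset.sum_sub_distrib,
      e1] at h2
    simp [hF] at h2
    have := D.pathsN_self' y
    omega
  · exact (hne y hy).1

/-- An orbit not reached from the fixed points would be reached along at most three paths from a
fixed point with edges to just one orbit. -/
theorem exists_W_eq_one (h6 : ∀ x, D.dout x = 6) [Nonempty F] (j : ι) : ∃ x, D.W x j = 1 := by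
  by_contra! h
  have h0 : ∀ x, D.W x j = 0 := fun x => (D.W_bit x j).resolve_right (h x)
  obtain ⟨x⟩ := ‹Nonempty F›
  have h1 := D.sum_N_mul_W x j
  simp only [h0, mul_zero, Finset.sum_const_zero, zero_add, add_zero] at h1
  have h2 : ∑ i, D.W x i * D.r i j ≤ ∑ i, D.W x i * 3 :=
    Finset.sum_le_sum fun i _ => mul_le_mul_of_nonneg_left
      (by have := D.r_le i j; push_cast at this; exact this) (D.W_nonneg _ _)
  rw [← Finset.sum_mul] at h2
  have := D.dout_cases x
  rw [h6] at this
  omega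

/-- The other case, out- and in-degree six throughout, is impossible: there is an edge from a fixed
point to an orbit and an edge back to a fixed point, but no path of this kind. -/
theorem petersen_of_card_ten (hF : Fintype.card F = 10) [Nonempty ι] :
    (∀ y, D.dout y = 3) ∧ (∀ y z, D.N y z = D.N z y) ∧ ∀ y z, D.K y z = 1 := by
  have hne : Nonempty F := by rw [← Fintype.card_pos_iff]; omega
  by_cases h3 : ∃ x, D.dout x = 3
  · obtain ⟨x, hx⟩ := h3
    exact D.petersen_of_dout_three hF hx
  exfalso
  push Not at h3
  have h6 : ∀ x, D.dout x = 6 := fun x => (D.dout_of_card_ten hF x).resolve_left (h3 x)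
  have h6' : ∀ x, D.rev.dout x = 6 := by
    intro x
    refine (D.rev.dout_of_card_ten hF x).resolve_left fun hx => ?_
    obtain ⟨h1, h2, -⟩ := D.rev.petersen_of_dout_three hF hx
    have : D.dout x = D.rev.dout x := Finset.sum_congr rfl fun z _ => h2 z x
    rw [h6, h1] at this
    omega
  obtain ⟨j⟩ := ‹Nonempty ι›
  obtain ⟨x, hx⟩ := D.exists_W_eq_one h6 j
  obtain ⟨y, hy⟩ := D.rev.exists_W_eq_one h6' j
  have hK := D.K_eq_zero_of_dout_six hF h6 h6' x y
  rw [K, Finset.sum_eq_zero_iff_of_nonneg fun i _ =>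
    mul_nonneg (D.W_nonneg _ _) (D.U_nonneg _ _)] at hK
  have := hK j (Finset.mem_univ j)
  have hy' : D.U j y = 1 := hy
  rw [hx, hy'] at this
  omega

end Ten

end OrbitData

/-! ### Equitable partitions of the Petersen graph -/

namespace OrbitData

variable {F ι : Type*} [Fintype F] [Fintype ι] [DecidableEq F] [DecidableEq ι]

section Petersen

/-- A cubic graph on ten vertices has no two sets `χ`, `ψ` of vertices in which every `x` has
`3 - 2 χ(x) - ψ(x)` and `1 + ψ(x)` neighbours. Of the five vertices outside `ψ`, those in `χ` would
be twice as many as those outside `χ`. -/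
theorem false_of_partition {F : Type*} [Fintype F] {N : F → F → ℤ} {χ ψ : F → ℤ}
    (hF : Fintype.card F = 10)
    (hN : ∀ x y, N x y = 0 ∨ N x y = 1) (hsymm : ∀ x y, N x y = N y x)
    (hdeg : ∀ x, ∑ z, N x z = 3) (hχ : ∀ x, χ x = 0 ∨ χ x = 1) (hψ : ∀ x, ψ x = 0 ∨ ψ x = 1)
    (hNχ : ∀ x, ∑ z, N x z * χ z = 3 - 2 * χ x - ψ x)
    (hNψ : ∀ x, ∑ z, N x z * ψ z = 1 + ψ x) : False := by
  have hnn : ∀ x z, 0 ≤ N x z * (1 - χ z) := fun x z => by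
    rcases hN x z with h | h <;> rcases hχ z with h' | h' <;> simp [h, h']
  have hnn' : ∀ x z, 0 ≤ N x z * χ z := fun x z => by
    rcases hN x z with h | h <;> rcases hχ z with h' | h' <;> simp [h, h']
  have h1 : ∀ x, χ x = 0 → ψ x = 0 → ∑ z, N x z * (χ z * (1 - ψ z)) = 2 := by
    intro x hx hx'
    have h0 : ∑ z, N x z * (1 - χ z) = 0 := by
      simp only [mul_sub, mul_one, Finset.sum_sub_distrib, hdeg, hNχ]; omega
    rw [Finset.sum_eq_zero_iff_of_nonneg fun z _ => hnn x z] at h0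
    have e : ∀ z, N x z * (χ z * (1 - ψ z)) = N x z - N x z * ψ z := fun z => by
      have := h0 z (Finset.mem_univ z)
      linear_combination (ψ z - 1) * this
    simp only [e, Finset.sum_sub_distrib, hdeg, hNψ]
    omega
  have h2 : ∀ y, χ y = 1 → ψ y = 0 → ∑ z, N y z * ((1 - χ z) * (1 - ψ z)) = 1 := by
    intro y hy hy'
    have h0 : ∀ z, N y z * (χ z * ψ z) = 0 := by
      intro z
      rcases hχ z with h | h
      · simp [h]
      rcases hψ z with h' | h'
      · simp [h']
      rcases hN y z with h'' | h''
      · simp [h'']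
      exfalso
      have e := hNχ z
      rw [h, h', show (3 - 2 * 1 - 1 : ℤ) = 0 by rfl,
        Finset.sum_eq_zero_iff_of_nonneg fun z' _ => hnn' z z'] at e
      have := e y (Finset.mem_univ y)
      rw [← hsymm y z, h'', hy] at this
      omega
    have e : ∀ z, N y z * ((1 - χ z) * (1 - ψ z)) = N y z - N y z * χ z - N y z * ψ z := fun z => by
      linear_combination h0 z
    simp only [e, Finset.sum_sub_distrib, hdeg, hNψ, hNχ]
    omega
  have h3 : ∑ x, (1 - χ x) * (1 - ψ x) * ∑ z, N x z * (χ z * (1 - ψ z))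
      = ∑ y, χ y * (1 - ψ y) * ∑ z, N y z * ((1 - χ z) * (1 - ψ z)) := by
    simp only [Finset.mul_sum]
    rw [Finset.sum_comm]
    refine Finset.sum_congr rfl fun x _ => Finset.sum_congr rfl fun z _ => ?_
    rw [hsymm z x]; ring
  have h4 : ∀ x, (1 - χ x) * (1 - ψ x) * ∑ z, N x z * (χ z * (1 - ψ z))
      = (1 - χ x) * (1 - ψ x) * 2 := fun x => by
    rcases hχ x with h | h <;> rcases hψ x with h' | h'
    · rw [h1 x h h']
    all_goals simp [h, h']
  have h5 : ∀ y, χ y * (1 - ψ y) * ∑ z, N y z * ((1 - χ z) * (1 - ψ z)) = χ y * (1 - ψ y) :=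
    fun y => by
      rcases hχ y with h | h <;> rcases hψ y with h' | h'
      · simp [h]
      · simp [h]
      · rw [h2 y h h', mul_one]
      · simp [h']
  rw [Finset.sum_congr rfl fun x _ => h4 x, Finset.sum_congr rfl fun x _ => h5 x,
    ← Finset.sum_mul] at h3
  have h6 : ∑ x, (1 - χ x) * (1 - ψ x) + ∑ y, χ y * (1 - ψ y) = 10 - ∑ x, ψ x := by
    rw [← Finset.sum_add_distrib, Finset.sum_congr rfl fun x _ =>
      show (1 - χ x) * (1 - ψ x) + χ x * (1 - ψ x) = 1 - ψ x by ring, Finset.sum_sub_distrib]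
    simp [hF]
  have h7 : 3 * ∑ x, ψ x = 10 + ∑ x, ψ x := by
    have e := Finset.sum_congr rfl fun x (_ : x ∈ Finset.univ) => hNψ x
    rw [Finset.sum_comm, Finset.sum_add_distrib] at e
    simp only [← Finset.sum_mul] at e
    have hcol : ∀ z, ∑ x, N x z = 3 := fun z => by
      rw [← hdeg z]; exact Finset.sum_congr rfl fun x _ => hsymm x z
    simp only [hcol, ← Finset.mul_sum] at e
    simpa [hF] using e
  omega

variable (D : OrbitData 3 F (Fin 4))

/-- If the cross term with one block vanishes, then those with the other two blocks are maximal. -/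
theorem of_crossTerm_nonpos {i j k l : Fin 4}
    (h : ∀ f : Fin 4 → ℤ, ∑ n, f n = f i + f j + f k + f l)
    (hl : D.r i l = 0 ∨ D.r l i = 0) : D.r i i ≠ 1 ∧ (D.r i j = 1 ∨ D.r i j = 2) ∧
      D.r j i = D.r i j ∧ (D.r i k = 1 ∨ D.r i k = 2) ∧ D.r k i = D.r i k := by
  have h1 := D.sum_crossTerm i
  rw [h] at h1
  have h2 := D.crossTerm_self i
  obtain ⟨a1, a2, a3⟩ := D.crossTerm_cases i j
  obtain ⟨b1, b2, b3⟩ := D.crossTerm_cases i k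
  obtain ⟨c1, c2, c3⟩ := D.crossTerm_cases i l
  have hc : D.crossTerm i l ≤ 0 := by
    by_contra hpos
    have := c2 (by omega)
    omega
  have e1 : D.crossTerm i j = 2 := by omega
  have e2 : D.crossTerm i k = 2 := by omega
  have := a2 (by omega)
  have := b2 (by omega)
  have := a3 e1
  have := b3 e2
  refine ⟨by omega, by omega, by omega, by omega, by omega⟩

theorem r_sq_four (i j : Fin 4) : ∃ κ : ℤ, 3 * κ + (D.r i 0 * D.r 0 j + D.r i 1 * D.r 1 j
    + D.r i 2 * D.r 2 j + D.r i 3 * D.r 3 j) + D.r i j = 12 + if i = j then 2 else 0 := by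
  refine ⟨∑ z, D.U i z * D.W z j, ?_⟩
  have := D.r_sq i j
  rw [Fin.sum_univ_four] at this
  push_cast at this
  linarith

/-- The independent sets of size four split a Petersen graph into two orbit types; the block sizes
are then determined up to exchanging the first two orbits. -/
theorem r_of_split (h00 : D.r 0 0 + D.r 1 0 = 3) (h01 : D.r 0 1 + D.r 1 1 = 3)
    (h02 : D.r 0 2 + D.r 1 2 = 1) (h03 : D.r 0 3 + D.r 1 3 = 1)
    (h20 : D.r 2 0 + D.r 3 0 = 2) (h21 : D.r 2 1 + D.r 3 1 = 2)
    (h22 : D.r 2 2 + D.r 3 2 = 2) (h23 : D.r 2 3 + D.r 3 3 = 2) :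
    D.r 2 0 = 1 ∧ D.r 2 1 = 1 ∧ D.r 2 2 = 0 ∧ D.r 2 3 = 2 ∧
    D.r 3 0 = 1 ∧ D.r 3 1 = 1 ∧ D.r 3 2 = 2 ∧ D.r 3 3 = 0 ∧ D.r 0 0 = 2 ∧ D.r 0 1 = 1 ∧
    ((D.r 0 2 = 1 ∧ D.r 0 3 = 0) ∨ (D.r 0 2 = 0 ∧ D.r 0 3 = 1)) := by
  have s : ∀ f : Fin 4 → ℤ, ∑ n, f n = f 0 + f 1 + f 2 + f 3 := Fin.sum_univ_four
  have s1023 : ∀ f : Fin 4 → ℤ, ∑ n, f n = f 1 + f 0 + f 2 + f 3 := fun f => by rw [s]; ring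
  have s1032 : ∀ f : Fin 4 → ℤ, ∑ n, f n = f 1 + f 0 + f 3 + f 2 := fun f => by rw [s]; ring
  have s0132 : ∀ f : Fin 4 → ℤ, ∑ n, f n = f 0 + f 1 + f 3 + f 2 := fun f => by rw [s]; ring
  have s2301 : ∀ f : Fin 4 → ℤ, ∑ n, f n = f 2 + f 3 + f 0 + f 1 := fun f => by rw [s]; ring
  have s2310 : ∀ f : Fin 4 → ℤ, ∑ n, f n = f 2 + f 3 + f 1 + f 0 := fun f => by rw [s]; ring
  have s3201 : ∀ f : Fin 4 → ℤ, ∑ n, f n = f 3 + f 2 + f 0 + f 1 := fun f => by rw [s]; ring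
  have s3210 : ∀ f : Fin 4 → ℤ, ∑ n, f n = f 3 + f 2 + f 1 + f 0 := fun f => by rw [s]; ring
  have nn := D.r_nonneg
  have n02 := nn 0 2
  have n12 := nn 1 2
  have n03 := nn 0 3
  have n13 := nn 1 3
  rcases (show D.r 0 2 = 1 ∧ D.r 1 2 = 0 ∨ D.r 0 2 = 0 ∧ D.r 1 2 = 1 by omega) with h | h
  · have a1 := D.of_crossTerm_nonpos s1032 (Or.inl h.2)
    have a2 := D.of_crossTerm_nonpos s2301 (Or.inr h.2)
    have e03 : D.r 0 3 = 0 := by omega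
    have a4 := D.of_crossTerm_nonpos s (Or.inl e03)
    have a5 := D.of_crossTerm_nonpos s3210 (Or.inr e03)
    have := D.crossTerm_self 2
    have := D.crossTerm_self 3
    have := D.crossTerm_self 0
    have := D.crossTerm_self 1
    omega
  · have a1 := D.of_crossTerm_nonpos s0132 (Or.inl h.1)
    have a2 := D.of_crossTerm_nonpos s2310 (Or.inr h.1)
    have e13 : D.r 1 3 = 0 := by omega
    have a4 := D.of_crossTerm_nonpos s1023 (Or.inl e13)
    have a5 := D.of_crossTerm_nonpos s3201 (Or.inr e13)
    have := D.crossTerm_self 2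
    have := D.crossTerm_self 3
    have := D.crossTerm_self 0
    have := D.crossTerm_self 1
    omega

/-- The case in which the fixed points with edges to the orbits `0` and `1` form an independent set
of four vertices in the Petersen graph. The block sizes then make `U 0` and one of `U 2`, `U 3` the
two sets of `false_of_partition`. -/
theorem false_of_independent_split (hF : Fintype.card F = 10) (hdeg : ∀ y, D.dout y = 3)
    (hsymm : ∀ y z, D.N y z = D.N z y) (hU : ∀ y, D.U 0 y + D.U 1 y = 1)
    (hU' : ∀ y, D.U 2 y + D.U 3 y = 1)
    (h00 : D.r 0 0 + D.r 1 0 = 3) (h01 : D.r 0 1 + D.r 1 1 = 3)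
    (h02 : D.r 0 2 + D.r 1 2 = 1) (h03 : D.r 0 3 + D.r 1 3 = 1)
    (h20 : D.r 2 0 + D.r 3 0 = 2) (h21 : D.r 2 1 + D.r 3 1 = 2)
    (h22 : D.r 2 2 + D.r 3 2 = 2) (h23 : D.r 2 3 + D.r 3 3 = 2) : False := by
  obtain ⟨r20, r21, r22, r23, r30, r31, r32, r33, r00, r01, hr⟩ :=
    D.r_of_split h00 h01 h02 h03 h20 h21 h22 h23
  have hUN : ∀ i y, ∑ z, D.N y z * D.U i z + ∑ k, D.r i k * D.U k y + D.U i y = 4 := by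
    intro i y
    rw [← D.sum_U_mul_N i y]
    congr 2
    exact Finset.sum_congr rfl fun z _ => by rw [hsymm y z, mul_comm]
  rcases hr with hr | hr
  · refine false_of_partition (χ := D.U 0) (ψ := D.U 2) hF D.N_bit hsymm hdeg (D.U_bit 0)
      (D.U_bit 2) (fun x => ?_) (fun x => ?_)
    · have := hUN 0 x
      rw [Fin.sum_univ_four, r00, r01, hr.1, hr.2] at this
      have := hU x
      omega
    · have := hUN 2 x
      rw [Fin.sum_univ_four, r20, r21, r22, r23] at this
      have := hU x
      have := hU' x
      omega
  · refine false_of_partition (χ := D.U 0) (ψ := D.U 3) hF D.N_bit hsymm hdeg (D.U_bit 0)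
      (D.U_bit 3) (fun x => ?_) (fun x => ?_)
    · have := hUN 0 x
      rw [Fin.sum_univ_four, r00, r01, hr.1, hr.2] at this
      have := hU x
      omega
    · have := hUN 3 x
      rw [Fin.sum_univ_four, r30, r31, r32, r33] at this
      have := hU x
      have := hU' x
      omega

/-- The fixed points with edges to the first two orbits and those with edges to the last two form
an equitable partition of the Petersen graph. Such a partition consists of two pentagons, or of an
independent set of four vertices and its complement. -/
theorem false_of_split (hF : Fintype.card F = 10) (hdeg : ∀ y, D.dout y = 3)
    (hsymm : ∀ y z, D.N y z = D.N z y) (hK : ∀ y z, D.K y z = 1)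
    (hW : ∀ x, D.W x 0 = D.W x 1 ∧ D.W x 2 = D.W x 3 ∧ D.W x 0 + D.W x 2 = 1) : False := by
  have nn := D.r_nonneg
  have hsum : ∀ j, ∑ z, D.W z j + (D.r 0 j + D.r 1 j + D.r 2 j + D.r 3 j) = 9 := fun j => by
    rw [← Fin.sum_univ_four (fun i => D.r i j)]; exact D.sum_W_add_sum_r j
  have hc : ∑ _z : F, (1 : ℤ) = 10 := by simp [hF]
  have hex : ∀ j, ∃ x, D.W x j = 0 := by
    intro j
    by_contra! h
    have := hsum j
    rw [Finset.sum_congr rfl fun x _ => (D.W_bit x j).resolve_left (h x), hc] at this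
    have := nn 0 j
    have := nn 1 j
    have := nn 2 j
    have := nn 3 j
    omega
  obtain ⟨x0, hx0⟩ := hex 0
  obtain ⟨x1, hx1⟩ := hex 2
  have hx1 : D.W x1 0 = 1 := by have := hW x1; omega
  have hU : ∀ y, D.U 0 y + D.U 1 y = 1 := by
    intro y
    have h := hK x1 y
    obtain ⟨e1, e2, e3⟩ := hW x1
    rw [K, Fin.sum_univ_four, ← e1, ← e2, hx1, show D.W x1 2 = 0 by omega] at h
    omega
  have hU' : ∀ y, D.U 2 y + D.U 3 y = 1 := by
    intro y
    have h := hK x0 y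
    obtain ⟨e1, e2, e3⟩ := hW x0
    rw [K, Fin.sum_univ_four, ← e1, ← e2, hx0, show D.W x0 2 = 1 by omega] at h
    omega
  have hNW : ∀ x j, ∑ z, D.N x z * D.W z j + (D.W x 0 * (D.r 0 j + D.r 1 j)
      + D.W x 2 * (D.r 2 j + D.r 3 j)) + D.W x j = 4 := by
    intro x j
    have := D.sum_N_mul_W x j
    obtain ⟨e1, e2, e3⟩ := hW x
    rw [Fin.sum_univ_four, ← e1, ← e2] at this
    linarith
  have hN2 : ∀ x, ∑ z, D.N x z * D.W z 2 = 3 - ∑ z, D.N x z * D.W z 0 := by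
    intro x
    have e : ∀ z, D.N x z * D.W z 2 = D.N x z - D.N x z * D.W z 0 := fun z => by
      rw [show D.W z 2 = 1 - D.W z 0 by have := hW z; omega]; ring
    have h3 : ∑ z, D.N x z = 3 := hdeg x
    simp only [e, Finset.sum_sub_distrib, h3]
  have hN1 : ∀ x, ∑ z, D.N x z * D.W z 1 = ∑ z, D.N x z * D.W z 0 := fun x =>
    Finset.sum_congr rfl fun z _ => by rw [(hW z).1]
  have hN3 : ∀ x, ∑ z, D.N x z * D.W z 3 = ∑ z, D.N x z * D.W z 2 := fun x =>
    Finset.sum_congr rfl fun z _ => by rw [(hW z).2.1]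
  -- `a` and `b` count the neighbours of the first type of a vertex of the first, second type
  obtain ⟨a, ha⟩ : ∃ a, a = 3 - D.r 0 0 - D.r 1 0 := ⟨_, rfl⟩
  obtain ⟨b, hb⟩ : ∃ b, b = 4 - D.r 2 0 - D.r 3 0 := ⟨_, rfl⟩
  have hNω : ∀ x, ∑ z, D.N x z * D.W z 0 = a * D.W x 0 + b * (1 - D.W x 0) := by
    intro x
    have h := hNW x 0
    obtain ⟨e1, e2, e3⟩ := hW x
    rcases D.W_bit x 0 with h' | h'
    · rw [h', show D.W x 2 = 1 by omega] at h
      rw [h']; linarith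
    · rw [h', show D.W x 2 = 0 by omega] at h
      rw [h']; linarith
  have hsq : ∀ x, ∑ z, D.N x z * ∑ w, D.N z w * D.W w 0
      = ∑ z, D.W z 0 - ∑ z, D.N x z * D.W z 0 + 2 * D.W x 0 := by
    intro x
    have hp : ∀ w, D.pathsN x w = 1 - D.N x w + if w = x then 2 else 0 := by
      intro w
      by_cases hw : w = x
      · subst hw
        have := D.pathsN_self' w
        rw [hK] at this
        simp [D.N_self]; omega
      · simp [hw, (D.pathsN_of_dout_three (hdeg x) hw).1]
    have e : ∑ z, D.N x z * ∑ w, D.N z w * D.W w 0 = ∑ w, D.pathsN x w * D.W w 0 := by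
      simp only [Finset.mul_sum, pathsN, Finset.sum_mul]
      rw [Finset.sum_comm]
      simp only [mul_assoc]
    rw [e]
    simp only [hp, add_mul, sub_mul, one_mul, Finset.sum_add_distrib, Finset.sum_sub_distrib,
      ite_mul, zero_mul, Finset.sum_ite_eq', Finset.mem_univ, if_true]
  have hsq' : ∀ x, ∑ z, D.N x z * ∑ w, D.N z w * D.W w 0
      = a * ∑ z, D.N x z * D.W z 0 + b * (3 - ∑ z, D.N x z * D.W z 0) := by
    intro x
    rw [← hN2 x, Finset.mul_sum, Finset.mul_sum, ← Finset.sum_add_distrib]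
    refine Finset.sum_congr rfl fun z _ => ?_
    rw [hNω z, show D.W z 2 = 1 - D.W z 0 by have := hW z; omega]; ring
  have hc0 := hsum 0
  have q0 := hsq x0
  have q1 := hsq x1
  rw [hsq', hNω, hx0] at q0
  rw [hsq', hNω, hx1] at q1
  have t0 := hNω x0
  have t1 := hNω x1
  have bnd : ∀ x, 0 ≤ ∑ z, D.N x z * D.W z 0 ∧ 0 ≤ ∑ z, D.N x z * D.W z 2 := fun x =>
    ⟨Finset.sum_nonneg fun z _ => mul_nonneg (D.N_nonneg _ _) (D.W_nonneg _ _),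
     Finset.sum_nonneg fun z _ => mul_nonneg (D.N_nonneg _ _) (D.W_nonneg _ _)⟩
  have b0 := bnd x0
  have b1 := bnd x1
  rw [hN2] at b0 b1
  rw [hx0] at t0
  rw [hx1] at t1
  have ha0 : 0 ≤ a := by linarith
  have ha3 : a ≤ 3 := by linarith
  have hb0 : 0 ≤ b := by linarith
  have hb3 : b ≤ 3 := by linarith
  have hab : (a = 2 ∧ b = 1) ∨ (a = 0 ∧ b = 2) ∨ (a = 1 ∧ b = 3) := by
    rw [show ∑ z, D.W z 0 = 2 + a + b by linarith] at q0 q1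
    clear * - q0 q1 ha0 ha3 hb0 hb3
    interval_cases a <;> interval_cases b <;> omega
  have l0 := hNW x0
  have l1 := hNW x1
  obtain ⟨w01, w02, w03⟩ := hW x0
  obtain ⟨w11, w12, w13⟩ := hW x1
  have c01 := l0 1
  have c02 := l0 2
  have c03 := l0 3
  have c11 := l1 1
  have c12 := l1 2
  have c13 := l1 3
  rw [hN1] at c01 c11
  rw [hN3] at c03 c13
  rw [hN2] at c02 c12 c03 c13
  rw [t0, hx0, show D.W x0 2 = 1 by omega] at c01 c02 c03
  rw [t1, hx1, show D.W x1 2 = 0 by omega] at c11 c12 c13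
  have v01 : D.W x0 1 = 0 := by omega
  have v03 : D.W x0 3 = 1 := by omega
  have v11 : D.W x1 1 = 1 := by omega
  have v13 : D.W x1 3 = 0 := by omega
  rw [v01] at c01
  rw [v03] at c03
  rw [v11] at c11
  rw [v13] at c13
  rcases hab with ⟨rfl, rfl⟩ | ⟨rfl, rfl⟩ | ⟨rfl, rfl⟩
  · -- two pentagons
    have s : ∀ f : Fin 4 → ℤ, ∑ n, f n = f 0 + f 1 + f 2 + f 3 := Fin.sum_univ_four
    have s1 : ∀ f : Fin 4 → ℤ, ∑ n, f n = f 0 + f 2 + f 3 + f 1 := fun f => by rw [s]; ring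
    have s0 : ∀ f : Fin 4 → ℤ, ∑ n, f n = f 1 + f 2 + f 3 + f 0 := fun f => by rw [s]; ring
    have s3 : ∀ f : Fin 4 → ℤ, ∑ n, f n = f 3 + f 0 + f 1 + f 2 := fun f => by rw [s]; ring
    have s2 : ∀ f : Fin 4 → ℤ, ∑ n, f n = f 2 + f 0 + f 1 + f 3 := fun f => by rw [s]; ring
    have d0 : D.r 0 0 ≠ 1 := fun h => (D.of_crossTerm_nonpos s1 (Or.inr (by omega))).1 h
    have d1 : D.r 1 1 ≠ 1 := fun h => (D.of_crossTerm_nonpos (i := 1) (j := 2) (k := 3) (l := 0)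
      s0 (Or.inr (by omega))).1 h
    have d2 : D.r 2 2 ≠ 1 := fun h => (D.of_crossTerm_nonpos (i := 2) (j := 0) (k := 1) (l := 3)
      s2 (Or.inr (by omega))).1 h
    have d3 : D.r 3 3 ≠ 1 := fun h => (D.of_crossTerm_nonpos (i := 3) (j := 0) (k := 1) (l := 2)
      s3 (Or.inr (by omega))).1 h
    have n00 := nn 0 0
    have n11 := nn 1 1
    have n22 := nn 2 2
    have n33 := nn 3 3
    have n10 := nn 1 0
    have n01 := nn 0 1
    have n32 := nn 3 2
    have n23 := nn 2 3
    have r00 : D.r 0 0 = 0 := by omega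
    have r01 : D.r 0 1 = 1 := by omega
    have r10 : D.r 1 0 = 1 := by omega
    have r22 : D.r 2 2 = 0 := by omega
    have r32 : D.r 3 2 = 1 := by omega
    have r23 : D.r 2 3 = 1 := by omega
    have r33 : D.r 3 3 = 0 := by omega
    obtain ⟨κ1, k1⟩ := D.r_sq_four 0 2
    obtain ⟨κ2, k2⟩ := D.r_sq_four 0 3
    obtain ⟨κ3, k3⟩ := D.r_sq_four 0 0
    rw [r00, r01, r22, r32, if_neg (by decide)] at k1
    rw [r00, r01, r23, r33, if_neg (by decide)] at k2
    rw [r00, r01, r10, if_pos rfl] at k3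
    have m2 : D.r 0 2 ≤ 3 := D.r_le 0 2
    have m3 : D.r 0 3 ≤ 3 := D.r_le 0 3
    have n02 := nn 0 2
    have n03 := nn 0 3
    have e3 : D.r 0 3 = 0 ∨ D.r 0 3 = 3 := by omega
    have e2 : D.r 0 2 = 0 ∨ D.r 0 2 = 3 := by omega
    rcases e2 with e2 | e2 <;> rcases e3 with e3 | e3 <;> rw [e2, e3] at k3 <;> omega
  · exact D.false_of_independent_split hF hdeg hsymm hU hU' (by omega) (by omega) (by omega)
      (by omega) (by omega) (by omega) (by omega) (by omega)
  · -- exchange the roles of the two types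
    let σ : Fin 4 ≃ Fin 4 := (Equiv.swap 0 2).trans (Equiv.swap 1 3)
    have hσ : σ 0 = 2 ∧ σ 1 = 3 ∧ σ 2 = 0 ∧ σ 3 = 1 := by decide
    obtain ⟨σ0, σ1, σ2, σ3⟩ := hσ
    have hr : ∀ i j, (D.reindex σ).r i j = D.r (σ i) (σ j) := fun _ _ => rfl
    have hu : ∀ i y, (D.reindex σ).U i y = D.U (σ i) y := fun _ _ => rfl
    refine (D.reindex σ).false_of_independent_split hF hdeg hsymm ?_ ?_ ?_ ?_ ?_ ?_ ?_ ?_ ?_ ?_ <;>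
    simp only [hr, hu, σ0, σ1, σ2, σ3] <;> first | exact hU | exact hU' | omega

/-- A two-element subset `w` of four points determines a partition into two pairs, one of them
`{0, j}`. Every two-element set that meets `w` in one point meets both of these pairs in one
point. -/
theorem pairing_of_intersection {w : Fin 4 → ℤ} (hw : ∀ i, w i = 0 ∨ w i = 1)
    (hw2 : ∑ i, w i = 2) : ∃ j ≠ 0, w 0 = w j ∧
      ∀ u : Fin 4 → ℤ, ∑ i, u i = 2 → ∑ i, w i * u i = 1 → u 0 + u j = 1 := by
  simp only [Fin.sum_univ_four] at hw2 ⊢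
  rcases hw 0 with h0 | h0 <;> rcases hw 1 with h1 | h1 <;> rcases hw 2 with h2 | h2 <;>
    rcases hw 3 with h3 | h3 <;> rw [h0, h1, h2, h3] at hw2 <;> try omega
  · exact ⟨1, by decide, by rw [h0, h1], fun u _ _ => by rw [h0, h1, h2, h3] at *; omega⟩
  · exact ⟨2, by decide, by rw [h0, h2], fun u _ _ => by rw [h0, h1, h2, h3] at *; omega⟩
  · exact ⟨3, by decide, by rw [h0, h3], fun u _ _ => by rw [h0, h1, h2, h3] at *; omega⟩
  · exact ⟨3, by decide, by rw [h0, h3], fun u _ _ => by rw [h0, h1, h2, h3] at *; omega⟩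
  · exact ⟨2, by decide, by rw [h0, h2], fun u _ _ => by rw [h0, h1, h2, h3] at *; omega⟩
  · exact ⟨1, by decide, by rw [h0, h1], fun u _ _ => by rw [h0, h1, h2, h3] at *; omega⟩

/-- If all fixed points have edges to both or neither of the orbits `0` and `j`, then renaming the
orbits leads to `false_of_split`. -/
theorem false_of_pairing (hF : Fintype.card F = 10) (hdeg : ∀ y, D.dout y = 3)
    (hsymm : ∀ y z, D.N y z = D.N z y) (hK : ∀ y z, D.K y z = 1) (j : Fin 4) (hj : j ≠ 0)
    (hW : ∀ x, D.W x 0 = D.W x j) : False := by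
  let σ : Fin 4 ≃ Fin 4 := Equiv.swap 1 j
  have hσ : σ 0 = 0 ∧ σ 1 = j := ⟨by simp [σ, Equiv.swap_apply_def, hj.symm], by simp [σ]⟩
  have hw : ∀ x i, (D.reindex σ).W x i = D.W x (σ i) := fun _ _ => rfl
  refine (D.reindex σ).false_of_split hF hdeg hsymm (fun y z => ?_) (fun x => ?_)
  · rw [← hK y z]
    exact σ.sum_comp (fun i => D.W y i * D.U i z)
  · have h := (D.reindex σ).dout_cases x
    have h2 : (D.reindex σ).dout x = 3 := hdeg x
    have h3 : (D.reindex σ).W x 0 = (D.reindex σ).W x 1 := by rw [hw, hw, hσ.1, hσ.2, hW]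
    rw [h2, Fin.sum_univ_four] at h
    have := (D.reindex σ).W_bit x 0
    have := (D.reindex σ).W_bit x 2
    have := (D.reindex σ).W_bit x 3
    omega

/-- Pairs of orbits that meet each other in one point: the out-going pairs or the in-coming pairs
all belong to the same partition of the four orbits into two pairs. -/
theorem card_ne_ten_of_four (D : OrbitData 3 F (Fin 4)) : Fintype.card F ≠ 10 := by
  intro hF
  obtain ⟨hdeg, hsymm, hK⟩ := D.petersen_of_card_ten hF
  have hdeg' : ∀ y, D.rev.dout y = 3 := fun y => by
    rw [← hdeg y]; exact Finset.sum_congr rfl fun z _ => hsymm z y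
  have hK' : ∀ y z, D.rev.K y z = 1 := fun y z => by
    rw [← hK z y]; exact Finset.sum_congr rfl fun i _ => mul_comm _ _
  have hWs : ∀ x, ∑ i, D.W x i = 2 := fun x => by
    have := D.dout_cases x
    rw [hdeg] at this
    omega
  have hUs : ∀ x, ∑ i, D.U i x = 2 := fun x => by
    have : D.rev.dout x + 3 * ∑ i, D.U i x = 9 := D.rev.dout_cases x
    rw [hdeg'] at this
    omega
  have key : ∀ x, ∃ j ≠ 0, D.W x 0 = D.W x j ∧ ∀ y, D.U 0 y + D.U j y = 1 := by
    intro x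
    obtain ⟨j, hj, h1, h2⟩ := pairing_of_intersection (D.W_bit x) (hWs x)
    exact ⟨j, hj, h1, fun y => h2 (fun i => D.U i y) (hUs y) (hK x y)⟩
  have f1 : ∀ j, j ≠ 0 → ∃ x, D.W x 0 ≠ D.W x j := by
    intro j hj
    by_contra! h
    exact D.false_of_pairing hF hdeg hsymm hK j hj h
  have f2 : ∀ j, j ≠ 0 → ∃ x, D.U 0 x ≠ D.U j x := by
    intro j hj
    by_contra! h
    exact D.rev.false_of_pairing hF hdeg' (fun y z => hsymm z y) hK' j hj h
  obtain ⟨x, -⟩ := f1 1 (by decide)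
  obtain ⟨j, hj, -, hUj⟩ := key x
  obtain ⟨x', hx'⟩ := f1 j hj
  obtain ⟨k, hk, hWk, hUk⟩ := key x'
  have hjk : j ≠ k := by rintro rfl; exact hx' hWk
  -- the third pairing of the four orbits is respected by all in-coming pairs
  obtain ⟨l, hl, hs⟩ : ∃ l ≠ 0, ∀ f : Fin 4 → ℤ, ∑ n, f n = f 0 + f j + f k + f l := by
    have : ∃ l : Fin 4, l ≠ 0 ∧ l ≠ j ∧ l ≠ k := by clear * -; decide +revert
    obtain ⟨l, hl0, hlj, hlk⟩ := this
    refine ⟨l, hl0, fun f => ?_⟩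
    rw [Fin.sum_univ_four]
    clear * - hj hk hjk hl0 hlj hlk
    fin_cases j <;> fin_cases k <;> fin_cases l <;> simp at * <;> ring
  obtain ⟨y, hy⟩ := f2 l hl
  have h1 := hUs y
  rw [hs] at h1
  have := hUj y
  have := hUk y
  omega

end Petersen

end OrbitData

/-! ### Thirteen fixed points -/

namespace OrbitData

variable {F ι : Type*} [Fintype F] [Fintype ι] [DecidableEq F] [DecidableEq ι]

section Thirteen

variable (D : OrbitData 3 F (Fin 3))

theorem r_sq_three (i j : Fin 3) : 3 * ∑ z, D.U i z * D.W z j + (D.r i 0 * D.r 0 j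
    + D.r i 1 * D.r 1 j + D.r i 2 * D.r 2 j) + D.r i j = 12 + if i = j then 2 else 0 := by
  have := D.r_sq i j
  rw [Fin.sum_univ_three] at this
  push_cast at this
  linarith

/-- With three orbits all cross terms are maximal. -/
theorem r_values (i j : Fin 3) (hij : i ≠ j) :
    (D.r i i = 0 ∨ D.r i i = 2) ∧ (D.r i j = 1 ∨ D.r i j = 2) ∧ D.r j i = D.r i j := by
  have h1 := D.sum_crossTerm i
  have h2 := D.crossTerm_self i
  have h3 := fun k => D.crossTerm_cases i k
  obtain ⟨k, hk⟩ : ∃ k, ∀ f : Fin 3 → ℤ, ∑ n, f n = f i + f j + f k := by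
    have : ∃ k : Fin 3, k ≠ i ∧ k ≠ j := by clear * -; decide +revert
    obtain ⟨k, hki, hkj⟩ := this
    refine ⟨k, fun f => ?_⟩
    rw [Fin.sum_univ_three]
    clear * - hij hki hkj
    fin_cases i <;> fin_cases j <;> fin_cases k <;> simp at * <;> ring
  rw [hk] at h1
  obtain ⟨a1, a2, a3⟩ := h3 j
  obtain ⟨b1, -, -⟩ := h3 k
  have := a2 (by omega)
  have := a3 (by omega)
  omega

/-- The values of `r_values` that solve `r_sq_three` modulo three. -/
theorem r_cases : (D.r 0 0 = 0 ∧ D.r 1 1 = 0 ∧ D.r 2 2 = 0 ∧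
      (D.r 0 1 = 2 ∧ D.r 0 2 = 2 ∧ D.r 1 2 = 2 ∨ D.r 0 1 = 2 ∧ D.r 0 2 = 1 ∧ D.r 1 2 = 1 ∨
       D.r 0 1 = 1 ∧ D.r 0 2 = 2 ∧ D.r 1 2 = 1 ∨ D.r 0 1 = 1 ∧ D.r 0 2 = 1 ∧ D.r 1 2 = 2)) ∨
    (D.r 0 0 = 2 ∧ D.r 1 1 = 2 ∧ D.r 2 2 = 2 ∧
      (D.r 0 1 = 1 ∧ D.r 0 2 = 1 ∧ D.r 1 2 = 1 ∨ D.r 0 1 = 1 ∧ D.r 0 2 = 2 ∧ D.r 1 2 = 2 ∨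
       D.r 0 1 = 2 ∧ D.r 0 2 = 1 ∧ D.r 1 2 = 2 ∨ D.r 0 1 = 2 ∧ D.r 0 2 = 2 ∧ D.r 1 2 = 1)) := by
  obtain ⟨h00, h01, h10⟩ := D.r_values 0 1 (by decide)
  obtain ⟨h11, h12, h21⟩ := D.r_values 1 2 (by decide)
  obtain ⟨-, h02, h20⟩ := D.r_values 0 2 (by decide)
  obtain ⟨h22, -, -⟩ := D.r_values 2 0 (by decide)
  have e1 := D.r_sq_three 0 1
  have e2 := D.r_sq_three 0 2
  have e3 := D.r_sq_three 1 2
  rw [if_neg (by decide), h21] at e1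
  rw [if_neg (by decide)] at e2
  rw [if_neg (by decide), h10] at e3
  generalize ∑ z, D.U 0 z * D.W z 1 = κ1 at e1
  generalize ∑ z, D.U 0 z * D.W z 2 = κ2 at e2
  generalize ∑ z, D.U 1 z * D.W z 2 = κ3 at e3
  rcases h00 with h00 | h00 <;> rcases h11 with h11 | h11 <;> rcases h22 with h22 | h22 <;>
  rcases h01 with h01 | h01 <;> rcases h02 with h02 | h02 <;> rcases h12 with h12 | h12 <;>
  simp only [h00, h11, h22, h01, h02, h12] at e1 e2 e3 <;>
  first | (exfalso; omega) | simp [h00, h11, h22, h01, h02, h12]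

theorem sum_W_le_two (hF : Fintype.card F = 13) (x : F) : D.W x 0 + D.W x 1 + D.W x 2 ≤ 2 := by
  have h1 := D.dout_cases x
  have h2 := D.dout_ne_zero (by omega) x
  have h3 := D.dout_nonneg x
  rw [Fin.sum_univ_three] at h1
  omega

/-- The nine or twelve paths that leave a fixed point of out-degree three restrict the degrees of
its out-neighbours, which are also given by the block sizes. -/
theorem of_sum_W_eq_two (hF : Fintype.card F = 13) {x : F}
    (hx : D.W x 0 + D.W x 1 + D.W x 2 = 2) :
    D.dout x = 3 ∧ ∃ R, R = D.W x 0 * ∑ j, D.r 0 j + D.W x 1 * ∑ j, D.r 1 j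
      + D.W x 2 * ∑ j, D.r 2 j ∧ (R = 4 ∧ D.pathsN x x = 0 ∨ R = 5 ∧ D.pathsN x x = 3) := by
  have h1 := D.dout_cases x
  rw [Fin.sum_univ_three] at h1
  have hd : D.dout x = 3 := by omega
  refine ⟨hd, _, rfl, ?_⟩
  have h2 := D.sum_dout_of_dout_three hd
  have h3 := D.pathsN_self_of_dout_three hd
  have h4 : ∑ z, D.N x z * D.dout z = 9 * ∑ z, D.N x z - 3 * (∑ z, D.N x z * D.W z 0
      + ∑ z, D.N x z * D.W z 1 + ∑ z, D.N x z * D.W z 2) := by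
    rw [← Finset.sum_add_distrib, ← Finset.sum_add_distrib, Finset.mul_sum, Finset.mul_sum,
      ← Finset.sum_sub_distrib]
    refine Finset.sum_congr rfl fun z _ => ?_
    have := D.dout_cases z
    rw [Fin.sum_univ_three] at this
    linear_combination D.N x z * this
  have e0 := D.sum_N_mul_W x 0
  have e1 := D.sum_N_mul_W x 1
  have e2 := D.sum_N_mul_W x 2
  rw [Fin.sum_univ_three] at e0 e1 e2
  have h5 : ∑ z, D.N x z = 3 := hd
  rw [h4, h5, hF] at h2
  simp only [Fin.sum_univ_three]
  have h6 : D.W x 0 * (D.r 0 0 + D.r 0 1 + D.r 0 2) + D.W x 1 * (D.r 1 0 + D.r 1 1 + D.r 1 2)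
      + D.W x 2 * (D.r 2 0 + D.r 2 1 + D.r 2 2) = 10 - (∑ z, D.N x z * D.W z 0
      + ∑ z, D.N x z * D.W z 1 + ∑ z, D.N x z * D.W z 2) := by linarith
  rw [h6]
  push_cast at h2
  omega

theorem sum_sum_W : ∑ x, (D.W x 0 + D.W x 1 + D.W x 2) = 27 - ∑ j, ∑ i, D.r i j := by
  have e0 := D.sum_W_add_sum_r 0
  have e1 := D.sum_W_add_sum_r 1
  have e2 := D.sum_W_add_sum_r 2
  rw [Finset.sum_add_distrib, Finset.sum_add_distrib, Fin.sum_univ_three (fun j => ∑ i, D.r i j)]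
  linarith

/-- A fixed point without edges to the orbits has four out-neighbours with edges to each orbit. -/
theorem sum_r_le_five (hF : Fintype.card F = 13) (hle : ∀ x, D.W x 0 + D.W x 1 + D.W x 2 ≤ 1)
    (hlt : 14 < ∑ j, ∑ i, D.r i j) (j : Fin 3) : ∑ i, D.r i j ≤ 5 := by
  have hex : ∃ x, D.W x 0 + D.W x 1 + D.W x 2 = 0 := by
    by_contra! h
    have h1 : ∀ x, D.W x 0 + D.W x 1 + D.W x 2 = 1 := fun x => by
      have := hle x
      have := h x
      have := D.W_nonneg x 0
      have := D.W_nonneg x 1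
      have := D.W_nonneg x 2
      omega
    have h2 := D.sum_sum_W
    simp only [h1] at h2
    simp [hF] at h2
    omega
  obtain ⟨x, hx⟩ := hex
  have n0 := D.W_nonneg x 0
  have n1 := D.W_nonneg x 1
  have n2 := D.W_nonneg x 2
  have w0 : ∀ i, D.W x i = 0 := by
    intro i
    fin_cases i <;> simp only [Fin.zero_eta, Fin.mk_one, Fin.reduceFinMk] <;> omega
  have h1 := D.sum_N_mul_W x j
  simp only [w0, zero_mul, Finset.sum_const_zero, add_zero] at h1
  have h2 := D.sum_W_add_sum_r j
  have h3 : ∑ z, D.N x z * D.W z j ≤ ∑ z, D.W z j := Finset.sum_le_sum fun z _ =>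
    mul_le_of_le_one_left (D.W_nonneg _ _) (D.N_le_one _ _)
  omega

/-- For these block sizes no fixed point has edges to both of the orbits `0` and `1`, and the fixed
points with edges to two orbits have three reciprocal neighbours. -/
theorem types_of_r (hF : Fintype.card F = 13) (hr : D.r = ![![0, 2, 1], ![2, 0, 1], ![1, 1, 0]]) :
    (∀ x, D.W x 0 + D.W x 1 + D.W x 2 = 2 →
      D.dout x = 3 ∧ D.pathsN x x = 3 ∧ ∀ y, D.K x y = 1) ∧
    ∑ x, D.W x 0 = 6 ∧ ∑ x, D.W x 1 = 6 ∧ ∑ x, D.W x 2 = 7 ∧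
    ∀ x, D.W x 0 + D.W x 1 ≤ 1 := by
  have r0 : ∑ j, D.r 0 j = 3 := by rw [hr]; decide
  have r1 : ∑ j, D.r 1 j = 3 := by rw [hr]; decide
  have r2 : ∑ j, D.r 2 j = 2 := by rw [hr]; decide
  have c0 : ∑ i, D.r i 0 = 3 := by rw [hr]; decide
  have c1 : ∑ i, D.r i 1 = 3 := by rw [hr]; decide
  have c2 : ∑ i, D.r i 2 = 2 := by rw [hr]; decide
  have e0 := D.sum_W_add_sum_r 0
  have e1 := D.sum_W_add_sum_r 1
  have e2 := D.sum_W_add_sum_r 2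
  refine ⟨fun x hx => ?_, by omega, by omega, by omega, fun x => ?_⟩
  · obtain ⟨hd, R, hR, hR'⟩ := D.of_sum_W_eq_two hF hx
    rw [r0, r1, r2] at hR
    have hp : D.pathsN x x = 3 := by
      have := D.W_le_one x 2
      omega
    refine ⟨hd, hp, fun y => ?_⟩
    by_cases hy : y = x
    · subst hy
      have := D.pathsN_self' y
      omega
    · exact (D.pathsN_of_dout_three hd hy).2
  · by_contra h
    have := D.W_le_one x 0
    have := D.W_le_one x 1
    have := D.W_nonneg x 2
    have := D.sum_W_le_two hF x
    obtain ⟨hd, R, hR, hR'⟩ := D.of_sum_W_eq_two hF (x := x) (by omega)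
    rw [r0, r1, r2] at hR
    omega

theorem rev_r (hr : D.r = ![![0, 2, 1], ![2, 0, 1], ![1, 1, 0]]) :
    D.rev.r = ![![0, 2, 1], ![2, 0, 1], ![1, 1, 0]] := by
  funext i j
  rw [r_rev, hr]
  clear * -
  decide +revert

/-- Either no fixed point has edges to the orbits `0` and `2`, or none has edges to `1` and `2`:
otherwise the paths from two such points, which lead exactly once to each fixed point, would leave
no edges from the orbit `0` to the fixed points. Counting edges determines the types of the fixed points. -/
theorem types_dichotomy (hF : Fintype.card F = 13)
    (hr : D.r = ![![0, 2, 1], ![2, 0, 1], ![1, 1, 0]]) :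
    (∀ x, D.W x 0 ≤ D.W x 2 ∧ D.W x 1 + D.W x 2 = 1) ∨
    (∀ x, D.W x 1 ≤ D.W x 2 ∧ D.W x 0 + D.W x 2 = 1) := by
  obtain ⟨h1, h2, h3, h4, h5⟩ := D.types_of_r hF hr
  obtain ⟨-, u2, u3, u4, u5⟩ := D.rev.types_of_r hF (D.rev_r hr)
  have hc : ∑ _x : F, (1 : ℤ) = 13 := by simp [hF]
  have hb := D.W_bit
  -- not both of the types `{0, 2}` and `{1, 2}` occur
  have hnot : ¬ ((∃ x, D.W x 0 + D.W x 2 = 2) ∧ ∃ x, D.W x 1 + D.W x 2 = 2) := by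
    rintro ⟨⟨x, hx⟩, y, hy⟩
    have bx0 := hb x 0
    have bx1 := hb x 1
    have bx2 := hb x 2
    have by0 := hb y 0
    have by1 := hb y 1
    have by2 := hb y 2
    have hx5 := h5 x
    have hy5 := h5 y
    have kx := (h1 x (by omega)).2.2
    have ky := (h1 y (by omega)).2.2
    have hu0 : ∀ z, D.U 0 z = 0 := by
      intro z
      have k1 := kx z
      have k2 := ky z
      rw [K, Fin.sum_univ_three, show D.W x 0 = 1 by omega, show D.W x 1 = 0 by omega,
        show D.W x 2 = 1 by omega] at k1
      rw [K, Fin.sum_univ_three, show D.W y 0 = 0 by omega, show D.W y 1 = 1 by omega,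
        show D.W y 2 = 1 by omega] at k2
      have : D.U 0 z + D.U 1 z ≤ 1 := u5 z
      have := D.U_nonneg 0 z
      omega
    have : ∑ z, D.U 0 z = 6 := u2
    simp [hu0] at this
  rw [not_and_or] at hnot
  push Not at hnot
  rcases hnot with h | h
  · right
    have hle : ∀ x, D.W x 0 + D.W x 2 ≤ 1 := fun x => by
      have := h x; have := hb x 0; have := hb x 2; omega
    have hs : ∑ x, (D.W x 0 + D.W x 2) = ∑ _x : F, (1 : ℤ) := by
      rw [Finset.sum_add_distrib, hc]; omega
    have heq := (Finset.sum_eq_sum_iff_of_le fun x _ => hle x).mp hs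
    intro x
    have := heq x (Finset.mem_univ x)
    have := h5 x
    omega
  · left
    have hle : ∀ x, D.W x 1 + D.W x 2 ≤ 1 := fun x => by
      have := h x; have := hb x 1; have := hb x 2; omega
    have hs : ∑ x, (D.W x 1 + D.W x 2) = ∑ _x : F, (1 : ℤ) := by
      rw [Finset.sum_add_distrib, hc]; omega
    have heq := (Finset.sum_eq_sum_iff_of_le fun x _ => hle x).mp hs
    intro x
    have := heq x (Finset.mem_univ x)
    have := h5 x
    omega

/-- The fixed points with edges to the orbit `0` and those with edges from the orbit `1` form two
hexagons, which share a path of three vertices. The paths that end in an end `t` of that path are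
too few. -/
theorem false_of_types (hF : Fintype.card F = 13)
    (hr : D.r = ![![0, 2, 1], ![2, 0, 1], ![1, 1, 0]])
    (hW : ∀ x, D.W x 0 ≤ D.W x 2 ∧ D.W x 1 + D.W x 2 = 1)
    (hU : ∀ x, D.U 1 x ≤ D.U 2 x ∧ D.U 0 x + D.U 2 x = 1) : False := by
  have nnN := D.N_nonneg
  have nnW := D.W_nonneg
  have nnU := D.U_nonneg
  have r00 : D.r 0 0 = 0 := by rw [hr]; rfl
  have r01 : D.r 0 1 = 2 := by rw [hr]; rfl
  have r02 : D.r 0 2 = 1 := by rw [hr]; rfl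
  have r10 : D.r 1 0 = 2 := by rw [hr]; rfl
  have r11 : D.r 1 1 = 0 := by rw [hr]; rfl
  have r12 : D.r 1 2 = 1 := by rw [hr]; rfl
  have r20 : D.r 2 0 = 1 := by rw [hr]; rfl
  have r21 : D.r 2 1 = 1 := by rw [hr]; rfl
  obtain ⟨hW1, hW2, -, -, -⟩ := D.types_of_r hF hr
  obtain ⟨hU1, hU2, -, -, -⟩ := D.rev.types_of_r hF (D.rev_r hr)
  have hU2 : ∑ x, D.U 0 x = 6 := hU2
  -- the edges at a vertex of the first hexagon
  have X3 : ∀ x, D.W x 0 = 1 → D.dout x = 3 ∧ D.pathsN x x = 3 := fun x hx => by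
    have := hW x
    have := D.W_le_one x 2
    have := hW1 x (by omega)
    exact ⟨this.1, this.2.1⟩
  have Xrec : ∀ x z, D.W x 0 = 1 → D.N x z = 1 → D.N z x = 1 := by
    intro x z hx hxz
    obtain ⟨h1, h2⟩ := X3 x hx
    rw [← h1, pathsN, dout] at h2
    have h3 := (Finset.sum_eq_sum_iff_of_le fun w _ =>
      mul_le_of_le_one_right (D.N_nonneg x w) (D.N_le_one w x)).mp h2 z (Finset.mem_univ z)
    rwa [hxz, one_mul] at h3
  have XX : ∀ x, D.W x 0 = 1 → ∑ z, D.N x z * D.W z 0 = 2 := by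
    intro x hx
    have h := D.sum_N_mul_W x 0
    have := hW x
    have := D.W_le_one x 2
    rw [Fin.sum_univ_three, r00, r10, r20, hx, show D.W x 1 = 0 by omega,
      show D.W x 2 = 1 by omega] at h
    omega
  have XY : ∀ x, D.W x 0 = 1 → ∑ z, D.N x z * D.W z 1 = 1 := by
    intro x hx
    have h := D.sum_N_mul_W x 1
    have := hW x
    have := D.W_le_one x 2
    rw [Fin.sum_univ_three, r01, r11, r21, hx, show D.W x 1 = 0 by omega,
      show D.W x 2 = 1 by omega] at h
    omega
  have XnX : ∀ x z, D.W x 0 = 1 → D.N x z = 1 → D.W z 0 = 0 → D.W z 1 = 1 := by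
    intro x z hx hxz hz
    have h1 : ∑ w, D.N x w = 3 := (X3 x hx).1
    have h2 : ∑ w, D.N x w * (1 - D.W w 0 - D.W w 1) = 0 := by
      simp only [mul_sub, mul_one, Finset.sum_sub_distrib, h1, XX x hx, XY x hx]
      norm_num
    rw [Finset.sum_eq_zero_iff_of_nonneg fun w _ => mul_nonneg (nnN _ _)
      (by have := hW w; omega)] at h2
    have := h2 z (Finset.mem_univ z)
    rw [hxz, hz] at this
    omega
  -- the edges at a vertex of the second hexagon
  have X3' : ∀ x, D.U 1 x = 1 → D.rev.dout x = 3 ∧ D.rev.pathsN x x = 3 := fun x hx => by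
    have := hU x
    have := D.U_le_one 2 x
    have e : ∀ i, D.rev.W x i = D.U i x := fun _ => rfl
    have := hU1 x (by rw [e, e, e]; omega)
    exact ⟨this.1, this.2.1⟩
  have Xrec' : ∀ x z, D.U 1 x = 1 → D.N z x = 1 → D.N x z = 1 := by
    intro x z hx hxz
    obtain ⟨h1, h2⟩ := X3' x hx
    rw [← h1, pathsN, dout] at h2
    have h3 := (Finset.sum_eq_sum_iff_of_le fun w _ =>
      mul_le_of_le_one_right (D.rev.N_nonneg x w) (D.rev.N_le_one w x)).mp h2 z (Finset.mem_univ z)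
    change D.N z x * D.N x z = D.N z x at h3
    rwa [hxz, one_mul] at h3
  have XX' : ∀ x, D.U 1 x = 1 → ∑ z, D.U 1 z * D.N z x = 2 := by
    intro x hx
    have h := D.sum_U_mul_N 1 x
    have := hU x
    have := D.U_le_one 2 x
    rw [Fin.sum_univ_three, r10, r11, r12, hx, show D.U 0 x = 0 by omega,
      show D.U 2 x = 1 by omega] at h
    omega
  have YY' : ∀ x, D.U 0 x = 1 → ∑ z, D.U 0 z * D.N z x = 3 := by
    intro x hx
    have h := D.sum_U_mul_N 0 x
    have := hU x
    have := D.U_nonneg 1 x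
    rw [Fin.sum_univ_three, r00, r01, r02, hx, show D.U 1 x = 0 by omega,
      show D.U 2 x = 0 by omega] at h
    omega
  have paths' : ∀ x z, D.U 1 x = 1 → z ≠ x → D.pathsN z x + D.N z x = 1 := by
    intro x z hx hz
    have h1 := (D.rev.pathsN_of_dout_three (X3' x hx).1 hz).1
    have h2 : D.rev.pathsN x z = D.pathsN z x := Finset.sum_congr rfl fun w _ => mul_comm _ _
    have h3 : D.rev.N x z = D.N z x := rfl
    omega
  -- sizes of the intersections
  have cT : ∑ z, D.U 1 z * D.W z 0 = 3 := by
    have := D.r_sq_three 1 0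
    rw [r00, r10, r11, r12, r20, if_neg (by decide)] at this
    omega
  have cS : ∑ z, D.U 0 z * D.W z 0 = 3 := by
    have := D.r_sq_three 0 0
    rw [r00, r01, r02, r10, r20, if_pos rfl] at this
    omega
  have cQ : ∑ z, D.U 0 z * D.W z 1 = 3 := by
    have := D.r_sq_three 0 1
    rw [r00, r01, r02, r11, r21, if_neg (by decide)] at this
    omega
  have hXU : ∀ x, D.W x 0 = 1 → D.U 0 x + D.U 1 x = 1 := by
    intro x hx
    have h2 : ∑ w, D.W w 0 * (1 - D.U 0 w - D.U 1 w) = 0 := by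
      have : ∀ w, D.W w 0 * (1 - D.U 0 w - D.U 1 w)
        = D.W w 0 - D.U 0 w * D.W w 0 - D.U 1 w * D.W w 0 := fun w => by ring
      simp only [this, Finset.sum_sub_distrib, cT, cS, hW2]
      norm_num
    rw [Finset.sum_eq_zero_iff_of_nonneg fun w _ => mul_nonneg (nnW _ _)
      (by have := hU w; omega)] at h2
    have := h2 x (Finset.mem_univ x)
    rw [hx] at this
    omega
  -- `S` is the part of the first hexagon outside the second one
  obtain ⟨S, hS⟩ : ∃ S : F → ℤ, ∀ z, S z = D.U 0 z * D.W z 0 := ⟨_, fun _ => rfl⟩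
  have nnS : ∀ z, 0 ≤ S z := fun z => by rw [hS]; exact mul_nonneg (nnU _ _) (nnW _ _)
  have Sbit : ∀ z, S z = 0 ∨ (S z = 1 ∧ D.U 0 z = 1 ∧ D.W z 0 = 1) := fun z => by
    rw [hS]
    rcases D.U_bit 0 z with h | h <;> rcases D.W_bit z 0 with h' | h' <;> simp [h, h']
  obtain ⟨g, hg⟩ : ∃ g : F → ℤ, ∀ z, g z = ∑ s, S s * D.N s z := ⟨_, fun _ => rfl⟩
  have hg1 : ∀ p, D.U 0 p = 1 → D.W p 1 = 1 → 1 ≤ g p := by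
    intro p hp hp'
    have h1 := YY' p hp
    have h2 : ∑ z, D.U 0 z * D.N z p = g p + ∑ z, D.U 0 z * (1 - D.W z 0) * D.N z p := by
      rw [hg, ← Finset.sum_add_distrib]
      exact Finset.sum_congr rfl fun z _ => by rw [hS]; ring
    have h3 : ∑ z, D.U 0 z * (1 - D.W z 0) = 3 := by
      simp only [mul_sub, mul_one, Finset.sum_sub_distrib, cS, hU2]
      norm_num
    have hp0 : D.W p 0 = 0 := by have := hW p; have := nnW p 0; omega
    have h4 : ∑ z, D.U 0 z * (1 - D.W z 0) * D.N z p + 1 ≤ ∑ z, D.U 0 z * (1 - D.W z 0) := by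
      have e : (1 : ℤ) = ∑ z, if z = p then 1 else 0 := by simp
      nth_rewrite 2 [e]
      rw [← Finset.sum_add_distrib]
      refine Finset.sum_le_sum fun z _ => ?_
      by_cases hz : z = p
      · subst hz; simp [D.N_self, hp, hp0]
      · simp only [hz, if_false, add_zero]
        exact mul_le_of_le_one_right
          (mul_nonneg (nnU _ _) (by have := D.W_le_one z 0; omega)) (D.N_le_one _ _)
    omega
  -- the vertices of `S` and of the set `Q` of size three given by `U 0` and `W 1` are matched
  have hSQ : ∀ s z, S s = 1 → D.W z 1 = 1 → D.N s z = 1 → D.U 0 z = 1 := by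
    have h1 : ∑ z, D.U 0 z * D.W z 1 ≤ ∑ z, D.U 0 z * D.W z 1 * g z := by
      refine Finset.sum_le_sum fun z _ => ?_
      rcases D.U_bit 0 z with h | h
      · simp [h]
      rcases D.W_bit z 1 with h' | h'
      · simp [h']
      · rw [h, h']; have := hg1 z h h'; omega
    have h2 : ∑ s, ∑ z, S s * (D.N s z * (D.W z 1 * (1 - D.U 0 z)))
        = 3 - ∑ z, D.U 0 z * D.W z 1 * g z := by
      have e1 : ∑ s, ∑ z, S s * (D.N s z * D.W z 1) = 3 := by
        rw [← cS]
        refine Finset.sum_congr rfl fun s _ => ?_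
        rw [← Finset.mul_sum, ← hS]
        rcases Sbit s with h | ⟨h, -, h'⟩
        · simp [h]
        · rw [XY s h', mul_one]
      have e2 : ∑ z, D.U 0 z * D.W z 1 * g z = ∑ s, ∑ z, S s * (D.N s z * (D.W z 1 * D.U 0 z)) := by
        rw [Finset.sum_comm]
        refine Finset.sum_congr rfl fun z _ => ?_
        rw [hg, Finset.mul_sum]
        exact Finset.sum_congr rfl fun s _ => by ring
      rw [e2]
      rw [← e1]
      simp only [← Finset.sum_sub_distrib]
      exact Finset.sum_congr rfl fun s _ => Finset.sum_congr rfl fun z _ => by ring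
    have nn2 : ∀ s z, 0 ≤ S s * (D.N s z * (D.W z 1 * (1 - D.U 0 z))) := fun s z =>
      mul_nonneg (nnS _) (mul_nonneg (nnN _ _) (mul_nonneg (nnW _ _)
        (by have := D.U_le_one 0 z; omega)))
    have h3 : ∑ s, ∑ z, S s * (D.N s z * (D.W z 1 * (1 - D.U 0 z))) = 0 := by
      refine le_antisymm (by omega) (Finset.sum_nonneg fun s _ => Finset.sum_nonneg fun z _ => nn2 s z)
    intro s z hs hz hsz
    rw [Finset.sum_eq_zero_iff_of_nonneg fun s _ => Finset.sum_nonneg fun z _ => nn2 s z] at h3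
    have h4 := h3 s (Finset.mem_univ s)
    rw [Finset.sum_eq_zero_iff_of_nonneg fun z _ => nn2 s z] at h4
    have h5 := h4 z (Finset.mem_univ z)
    rw [hs, hz, hsz] at h5
    omega
  -- the intersection `T` of the hexagons
  have hTcard : (Finset.univ.filter fun z => D.U 1 z = 1 ∧ D.W z 0 = 1).card = 3 := by
    have : ∀ z, D.U 1 z * D.W z 0 = if D.U 1 z = 1 ∧ D.W z 0 = 1 then 1 else 0 := fun z => by
      rcases D.U_bit 1 z with h | h <;> rcases D.W_bit z 0 with h' | h' <;> simp [h, h']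
    simp only [this, Finset.sum_boole] at cT
    exact_mod_cast cT
  have hTsymm : ∀ t z, D.U 1 t = 1 → D.W t 0 = 1 → D.N z t = D.N t z := by
    intro t z h1 h2
    rcases D.N_bit z t with h | h
    · rcases D.N_bit t z with h' | h'
      · rw [h, h']
      · have := Xrec t z h2 h'; omega
    · rw [h, Xrec' t z h1 h]
  -- the two neighbours on the first hexagon lie in `T` or in `S`
  have hTS : ∀ t, D.W t 0 = 1 → ∑ z, D.N t z * (D.U 1 z * D.W z 0) + ∑ z, D.N t z * S z = 2 := by
    intro t ht
    rw [← XX t ht, ← Finset.sum_add_distrib]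
    refine Finset.sum_congr rfl fun z _ => ?_
    rw [hS]
    rcases D.W_bit z 0 with h | h
    · simp [h]
    · have := hXU z h
      rw [h, show D.U 0 z = 1 - D.U 1 z by omega]; ring
  -- the two neighbours on the second hexagon lie in `T` or outside the first one
  have hTnot : ∀ t, D.U 1 t = 1 → D.W t 0 = 1 →
      ∑ z, D.N t z * (D.U 1 z * D.W z 0) + ∑ z, D.N t z * (D.U 1 z * D.W z 1) = 2 := by
    intro t ht ht'
    rw [← XX' t ht, ← Finset.sum_add_distrib]
    refine Finset.sum_congr rfl fun z _ => ?_
    rw [hTsymm t z ht ht']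
    rcases D.N_bit t z with h | h
    · simp [h]
    rcases D.W_bit z 0 with h' | h'
    · rw [h, h', XnX t z ht' h h']; ring
    · have := hW z
      have := D.W_le_one z 2
      rw [h, h', show D.W z 1 = 0 by omega]; ring
  have hTone : ∀ t, D.U 1 t = 1 → D.W t 0 = 1 → ∑ z, D.N t z * (D.U 1 z * D.W z 1) ≤ 1 := by
    intro t ht ht'
    rw [← XY t ht']
    refine Finset.sum_le_sum fun z _ => mul_le_mul_of_nonneg_left ?_ (nnN _ _)
    exact mul_le_of_le_one_left (nnW _ _) (D.U_le_one _ _)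
  -- an end `t` of the path formed by `T`, with neighbour `c` in `T`
  have final : ∀ t c e, D.U 1 t = 1 → D.W t 0 = 1 → D.U 1 c = 1 → D.W c 0 = 1 →
      D.N t c = 1 → D.N t e = 0 → (∑ z, D.N c z * (D.U 1 z * D.W z 0) = 2) →
      (∀ z, D.U 1 z = 1 → D.W z 0 = 1 → z = t ∨ z = c ∨ z = e) → False := by
    intro t c e ht ht' hc hc' htc hte hc2 hall
    have nT : ∑ z, D.N t z * (D.U 1 z * D.W z 0) = 1 := by
      rw [Finset.sum_eq_single c, htc, hc, hc']; · norm_num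
      · intro z _ hz
        rcases D.U_bit 1 z with h | h
        · simp [h]
        rcases D.W_bit z 0 with h' | h'
        · simp [h']
        rcases hall z h h' with rfl | rfl | rfl
        · simp [D.N_self]
        · exact absurd rfl hz
        · simp [hte]
      · simp
    have nS : ∑ z, D.N t z * S z = 1 := by have := hTS t ht'; omega
    have nSc : g c = 0 := by
      have := hTS c hc'
      rw [hg, Finset.sum_congr rfl fun s _ => show S s * D.N s c = D.N c s * S s by
        rw [hTsymm c s hc hc', mul_comm]]
      omega
    have nY : ∀ z, D.N t z = 1 → D.W z 1 = 1 → D.U 1 z = 1 := by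
      intro z hz hz'
      have h1 := hTnot t ht ht'
      have h2 : ∑ z, D.N t z * (D.U 1 z * D.W z 1) = ∑ z, D.N t z * D.W z 1 := by
        rw [XY t ht']; omega
      have h3 := (Finset.sum_eq_sum_iff_of_le fun z _ => mul_le_mul_of_nonneg_left
        (mul_le_of_le_one_left (nnW z 1) (D.U_le_one 1 z)) (nnN t z)).mp h2 z (Finset.mem_univ z)
      rw [hz, hz'] at h3
      omega
    -- each of the three vertices of `S` has an edge or a path to `t`
    have hcount : ∑ s, S s * (D.pathsN s t + D.N s t) = 3 := by
      rw [← cS]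
      refine Finset.sum_congr rfl fun s _ => ?_
      rw [← hS]
      rcases Sbit s with h | ⟨h, h', h''⟩
      · simp [h]
      · rw [paths' t s ht, mul_one]
        rintro rfl
        have := hXU s h''
        omega
    have hsplit : ∑ s, S s * (D.pathsN s t + D.N s t) = ∑ z, g z * D.N t z + 1 := by
      rw [← nS]
      have e1 : ∑ s, S s * D.pathsN s t = ∑ z, g z * D.N t z := by
        simp only [pathsN, Finset.mul_sum]
        rw [Finset.sum_comm]
        refine Finset.sum_congr rfl fun z _ => ?_
        rw [hg, Finset.sum_mul, hTsymm t z ht ht']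
        exact Finset.sum_congr rfl fun s _ => by ring
      rw [← e1, ← Finset.sum_add_distrib]
      refine Finset.sum_congr rfl fun s _ => ?_
      rw [hTsymm t s ht ht']; ring
    have hle : ∑ z, g z * D.N t z ≤ ∑ z, D.N t z * S z := by
      refine Finset.sum_le_sum fun z _ => ?_
      rcases D.N_bit t z with h | h
      · simp [h]
      rw [h, mul_one, one_mul]
      rcases D.W_bit z 0 with hz | hz
      · -- the neighbour outside the first hexagon
        have h1 := XnX t z ht' h hz
        have h2 := nY z h h1
        have h3 : g z = 0 := by
          rw [hg]
          refine Finset.sum_eq_zero fun s _ => ?_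
          rcases Sbit s with h4 | ⟨h4, -, -⟩
          · simp [h4]
          rcases D.N_bit s z with h5 | h5
          · simp [h5]
          · have h6 := hSQ s z h4 h1 h5
            have := hU z
            omega
        rw [h3]; exact nnS z
      · rcases D.U_bit 1 z with hz' | hz'
        · -- the neighbour in `S`, for which `t` is one of two neighbours on the first hexagon
          have hz0 : D.U 0 z = 1 := by have := hXU z hz; omega
          have h1 := hTS z hz
          have h2 : 1 ≤ ∑ w, D.N z w * (D.U 1 w * D.W w 0) := by
            have := Finset.single_le_sum (f := fun w => D.N z w * (D.U 1 w * D.W w 0))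
              (fun w _ => mul_nonneg (nnN _ _) (mul_nonneg (nnU _ _) (nnW _ _))) (Finset.mem_univ t)
            simp only [hTsymm t z ht ht', h, ht, ht'] at this
            omega
          have h3 : g z ≤ ∑ w, D.N z w * S w := by
            rw [hg]
            refine Finset.sum_le_sum fun s _ => ?_
            rcases Sbit s with h4 | ⟨h4, -, h5⟩
            · simp [h4]
            rcases D.N_bit s z with h6 | h6
            · rw [h6, h4]; have := nnN z s; omega
            · rw [h4, h6, Xrec s z h5 h6]
          rw [hS, hz0, hz]
          omega
        · have hzc : z = c := by
            rcases hall z hz' hz with rfl | rfl | rfl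
            · rw [D.N_self] at h; omega
            · rfl
            · rw [hte] at h; omega
          rw [hzc, nSc]; exact nnS c
    omega
  -- `T` is a path
  obtain ⟨t0, t1, t2, h01, h02, h12, hT⟩ := Finset.card_eq_three.mp hTcard
  have mem : ∀ z, (D.U 1 z = 1 ∧ D.W z 0 = 1) ↔ z = t0 ∨ z = t1 ∨ z = t2 := by
    intro z
    have := congrArg (z ∈ ·) hT
    simpa using this
  obtain ⟨a0, b0⟩ := (mem t0).mpr (by simp)
  obtain ⟨a1, b1⟩ := (mem t1).mpr (by simp)
  obtain ⟨a2, b2⟩ := (mem t2).mpr (by simp)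
  have hsum : ∀ x, ∑ z, D.N x z * (D.U 1 z * D.W z 0) = D.N x t0 + D.N x t1 + D.N x t2 := by
    intro x
    have : ∀ z, D.N x z * (D.U 1 z * D.W z 0)
        = if z ∈ ({t0, t1, t2} : Finset F) then D.N x z else 0 := by
      intro z
      by_cases hz : D.U 1 z = 1 ∧ D.W z 0 = 1
      · rw [if_pos (by simpa using (mem z).mp hz), hz.1, hz.2]; ring
      · rw [if_neg (by rw [mem] at hz; simpa using hz)]
        rcases D.U_bit 1 z with h | h
        · simp [h]
        · rcases D.W_bit z 0 with h' | h'
          · simp [h']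
          · exact absurd ⟨h, h'⟩ hz
    simp only [this, Finset.sum_ite_mem, Finset.univ_inter]
    rw [Finset.sum_insert (by simp [h01, h02]), Finset.sum_pair h12]
    ring
  have d0 := hTnot t0 a0 b0
  have d1 := hTnot t1 a1 b1
  have d2 := hTnot t2 a2 b2
  have o0 := hTone t0 a0 b0
  have o1 := hTone t1 a1 b1
  have o2 := hTone t2 a2 b2
  rw [hsum, D.N_self] at d0 d1 d2
  have s01 := hTsymm t0 t1 a0 b0
  have s02 := hTsymm t0 t2 a0 b0
  have s12 := hTsymm t1 t2 a1 b1
  have tri : ¬ (D.N t0 t1 = 1 ∧ D.N t1 t2 = 1 ∧ D.N t0 t2 = 1) := by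
    rintro ⟨e1, e2, e3⟩
    have h1 := (D.pathsN_of_dout_three (X3 t0 b0).1 h02.symm).1
    have h2 := Finset.single_le_sum (f := fun w => D.N t0 w * D.N w t2)
      (fun w _ => mul_nonneg (nnN _ _) (nnN _ _)) (Finset.mem_univ t1)
    simp only [e1, e2] at h2
    rw [pathsN, e3] at h1
    omega
  have n01 := D.N_bit t0 t1
  have n02 := D.N_bit t0 t2
  have n12 := D.N_bit t1 t2
  rcases (show (D.N t0 t1 = 1 ∧ D.N t1 t2 = 1 ∧ D.N t0 t2 = 0) ∨
      (D.N t0 t1 = 1 ∧ D.N t1 t2 = 0 ∧ D.N t0 t2 = 1) ∨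
      (D.N t0 t1 = 0 ∧ D.N t1 t2 = 1 ∧ D.N t0 t2 = 1) by omega) with h | h | h
  · exact final t0 t1 t2 a0 b0 a1 b1 h.1 h.2.2 (by rw [hsum, D.N_self]; omega)
      fun z hz hz' => (mem z).mp ⟨hz, hz'⟩
  · exact final t1 t0 t2 a1 b1 a0 b0 (by omega) h.2.1 (by rw [hsum, D.N_self]; omega)
      fun z hz hz' => or_left_comm.mp ((mem z).mp ⟨hz, hz'⟩)
  · exact final t0 t2 t1 a0 b0 a2 b2 h.2.2 h.1 (by rw [hsum, D.N_self]; omega)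
      fun z hz hz' => ((mem z).mp ⟨hz, hz'⟩).imp_right Or.symm

/-- In two of the four combinations of types, a fixed point with edges to the orbits `0` and `2`, say,
and one with edges from both would be joined by two paths through orbits. -/
theorem false_of_r (hF : Fintype.card F = 13)
    (hr : D.r = ![![0, 2, 1], ![2, 0, 1], ![1, 1, 0]]) : False := by
  have htypes := D.types_of_r hF hr
  have hutypes := D.rev.types_of_r hF (D.rev_r hr)
  obtain ⟨h1, h2, h3, -, -⟩ := htypes
  obtain ⟨-, u2, u3, -, -⟩ := hutypes
  have hexW : ∀ j, ∑ x, D.W x j = 6 → ∃ x, D.W x j = 1 := by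
    intro j hj
    by_contra! h
    rw [Finset.sum_eq_zero fun x _ => (D.W_bit x j).resolve_right (h x)] at hj
    omega
  have hexU : ∀ j, ∑ x, D.U j x = 6 → ∃ x, D.U j x = 1 := by
    intro j hj
    by_contra! h
    rw [Finset.sum_eq_zero fun x _ => (D.U_bit j x).resolve_right (h x)] at hj
    omega
  have u2 : ∑ x, D.U 0 x = 6 := u2
  have u3 : ∑ x, D.U 1 x = 6 := u3
  have hud : (∀ x, D.U 0 x ≤ D.U 2 x ∧ D.U 1 x + D.U 2 x = 1) ∨
      (∀ x, D.U 1 x ≤ D.U 2 x ∧ D.U 0 x + D.U 2 x = 1) :=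
    D.rev.types_dichotomy hF (D.rev_r hr)
  rcases D.types_dichotomy hF hr with hW | hW <;> rcases hud with hU | hU
  · obtain ⟨x, hx⟩ := hexW 0 h2
    obtain ⟨y, hy⟩ := hexU 0 u2
    have e1 := hW x
    have e2 := hU y
    have := D.W_le_one x 2
    have := D.U_le_one 2 y
    have k := (h1 x (by omega)).2.2 y
    rw [K, Fin.sum_univ_three, hx, hy, show D.W x 1 = 0 by omega, show D.W x 2 = 1 by omega] at k
    omega
  · exact D.false_of_types hF hr hW hU
  · have s0 : (Equiv.swap 0 1 : Equiv.Perm (Fin 3)) 0 = 1 := by decide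
    have s1 : (Equiv.swap 0 1 : Equiv.Perm (Fin 3)) 1 = 0 := by decide
    have s2 : (Equiv.swap 0 1 : Equiv.Perm (Fin 3)) 2 = 2 := by decide
    have hw : ∀ x i, (D.reindex (Equiv.swap 0 1)).W x i = D.W x (Equiv.swap 0 1 i) :=
      fun _ _ => rfl
    have hu : ∀ x i, (D.reindex (Equiv.swap 0 1)).U i x = D.U (Equiv.swap 0 1 i) x :=
      fun _ _ => rfl
    refine (D.reindex (Equiv.swap 0 1)).false_of_types hF ?_
      (fun x => by rw [hw, hw, hw, s0, s1, s2]; exact hW x)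
      (fun x => by rw [hu, hu, hu, s0, s1, s2]; exact hU x)
    funext i j
    have e : (D.reindex (Equiv.swap 0 1)).r i j = D.r (Equiv.swap 0 1 i) (Equiv.swap 0 1 j) := rfl
    rw [e, hr]
    clear * -
    fin_cases i <;> fin_cases j <;> simp [Equiv.swap_apply_def]
  · obtain ⟨x, hx⟩ := hexW 1 h3
    obtain ⟨y, hy⟩ := hexU 1 u3
    have e1 := hW x
    have e2 := hU y
    have := D.W_le_one x 2
    have := D.U_le_one 2 y
    have k := (h1 x (by omega)).2.2 y
    rw [K, Fin.sum_univ_three, hx, hy, show D.W x 0 = 0 by omega, show D.W x 2 = 1 by omega] at k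
    omega

/-- Up to the order of the orbits only the block sizes of `false_of_r` remain: larger ones allow
each fixed point edges to at most one orbit, which does not fit the number of edges from the fixed
points to the orbits. -/
theorem card_ne_thirteen_of_three (D : OrbitData 3 F (Fin 3)) : Fintype.card F ≠ 13 := by
  intro hF
  obtain ⟨-, -, h10⟩ := D.r_values 0 1 (by decide)
  obtain ⟨-, -, h21⟩ := D.r_values 1 2 (by decide)
  obtain ⟨-, -, h20⟩ := D.r_values 0 2 (by decide)
  have hb := D.W_bit
  have h2 : ∀ x, D.W x 0 + D.W x 1 + D.W x 2 = 2 → D.W x 0 * (D.r 0 0 + D.r 0 1 + D.r 0 2)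
      + D.W x 1 * (D.r 1 0 + D.r 1 1 + D.r 1 2) + D.W x 2 * (D.r 2 0 + D.r 2 1 + D.r 2 2) ≤ 5 := by
    intro x hx
    obtain ⟨-, R, hR, hR'⟩ := D.of_sum_W_eq_two hF hx
    simp only [Fin.sum_univ_three] at hR
    omega
  -- if all row sums are at least three and some of them are larger, no fixed point has two orbits
  have h1 : (∀ i j, i ≠ j → 6 ≤ D.r i 0 + D.r i 1 + D.r i 2 + (D.r j 0 + D.r j 1 + D.r j 2)) →
      ∀ x, D.W x 0 + D.W x 1 + D.W x 2 ≤ 1 := by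
    intro hrow x
    by_contra hx
    have hx2 : D.W x 0 + D.W x 1 + D.W x 2 = 2 := by
      have := D.sum_W_le_two hF x
      omega
    have h3 := h2 x hx2
    have := hrow 0 1 (by decide)
    have := hrow 0 2 (by decide)
    have := hrow 1 2 (by decide)
    rcases hb x 0 with e0 | e0 <;> rcases hb x 1 with e1 | e1 <;> rcases hb x 2 with e2 | e2 <;>
      rw [e0, e1, e2] at h3 hx2 <;> omega
  have hc : ∑ _x : F, (1 : ℤ) = 13 := by simp [hF]
  have htot := D.sum_sum_W
  simp only [Fin.sum_univ_three] at htot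
  have hswap : ∀ σ : Equiv.Perm (Fin 3), ∀ i j, (D.reindex σ).r i j = D.r (σ i) (σ j) :=
    fun _ _ _ => rfl
  rcases D.r_cases with ⟨d0, d1, d2, h | h | h | h⟩ | ⟨d0, d1, d2, h⟩
  · have hle := h1 (by
      intro i j hij
      fin_cases i <;> fin_cases j <;>
        simp only [Fin.zero_eta, Fin.mk_one, Fin.reduceFinMk] at * <;> omega)
    have := Finset.sum_le_sum fun x (_ : x ∈ Finset.univ) => hle x
    omega
  · refine D.false_of_r hF ?_
    funext i j
    fin_cases i <;> fin_cases j <;> simp <;> omega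
  · refine (D.reindex (Equiv.swap 1 2)).false_of_r hF ?_
    funext i j
    rw [hswap]
    fin_cases i <;> fin_cases j <;> simp [Equiv.swap_apply_def] <;> omega
  · refine (D.reindex (Equiv.swap 0 2)).false_of_r hF ?_
    funext i j
    rw [hswap]
    fin_cases i <;> fin_cases j <;> simp [Equiv.swap_apply_def] <;> omega
  · have hle := h1 (by
      intro i j hij
      fin_cases i <;> fin_cases j <;>
        simp only [Fin.zero_eta, Fin.mk_one, Fin.reduceFinMk] at * <;> omega)
    rcases h with h | h
    · have := Finset.sum_le_sum fun x (_ : x ∈ Finset.univ) => hle x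
      omega
    · have hcol := D.sum_r_le_five hF hle (by simp only [Fin.sum_univ_three]; omega)
      have c0 := hcol 0
      have c1 := hcol 1
      have c2 := hcol 2
      simp only [Fin.sum_univ_three] at c0 c1 c2
      omega

end Thirteen

end OrbitData

/-! ### Automorphisms of prime order -/

theorem theorem4p1 {V : Type*} [Fintype V] (G : Digraph V) (hG : G.IsDSRG 22 9 6 3 4)
    (ρ : Equiv.Perm V) (hρ : ρ ∈ G.autGroup) (p : ℕ) (hp : p.Prime) (hord : orderOf ρ = p) :
    (p = 2 ∨ p = 3) ∧
      (p = 2 → (Function.fixedPoints ρ).ncard ∈ ({0, 6, 8, 10, 12, 14, 16} : Set ℕ)) ∧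
      (p = 3 → (Function.fixedPoints ρ).ncard = 1) := by
  have : Fact p.Prime := ⟨hp⟩
  obtain ⟨f, m, hf, hm, hcard, ⟨D⟩⟩ := OrbitData.exists_of_isDSRG hG hρ hord
  rw [← hf]
  have hne : Nonempty (Fin m) := ⟨⟨0, hm⟩⟩
  refine ⟨?_, ?_, ?_⟩
  · by_contra hnot
    push Not at hnot
    have hp2 := hp.two_le
    have hp4 : p ≠ 4 := by rintro rfl; exact absurd hp (by decide)
    rcases (show p = 5 ∨ p = 6 ∨ 7 ≤ p by omega) with rfl | rfl | h7
    · exact OrbitData.false_of_five D (by simp; omega)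
    · exact absurd hp (by decide)
    · have hF := D.isEmpty_of_seven_le h7
      have hf0 : f = 0 := by
        have h := Fintype.card_eq_zero_iff.mpr hF
        rwa [Fintype.card_fin] at h
      have hdvd : p ∣ 22 := ⟨m, by rw [← hcard, hf0]; ring⟩
      have hp22 : p ≤ 22 := Nat.le_of_dvd (by norm_num) hdvd
      have hp11 : p = 11 := by
        interval_cases p <;> first | rfl | omega | exact absurd hp (by decide)
      subst hp11
      exact OrbitData.false_of_eleven D (by simp; omega)
  · rintro rfl
    have h1 := OrbitData.three_le_card_of_two D ⟨0, hm⟩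
    have h2 := OrbitData.card_ne_two_of_two D
    have h3 := OrbitData.card_ne_four_of_two D
    simp only [Fintype.card_fin] at h1 h2 h3
    simp only [Set.mem_insert_iff, Set.mem_singleton_iff]
    omega
  · rintro rfl
    have h1 := OrbitData.three_le_card_of_three D ⟨0, hm⟩
    have h4 := OrbitData.card_ne_four_of_three D
    have h7 := OrbitData.card_ne_seven_of_three D
    simp only [Fintype.card_fin] at h1 h4 h7
    by_contra hf1
    rcases (show f = 10 ∧ m = 4 ∨ f = 13 ∧ m = 3 by omega) with ⟨rfl, rfl⟩ | ⟨rfl, rfl⟩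
    · exact OrbitData.card_ne_ten_of_four D (by simp)
    · exact OrbitData.card_ne_thirteen_of_three D (by simp)
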